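/- Consider regular expressions over an integer alphabet. An expression $\mathcal A$ of type $\circ+$ is a concatenation of positions, each of which is a single letter $a$ (language $\{a\}$) or $a^+$ (language $\{a^k : k\ge 1\}$), at least one position being of the second kind. An expression $\mathcal B$ of type $\circ|$ is a concatenation of positions, each of which is a single letter or an OR $[a_1|\cdots|a_r]$ of letters (language $\{a_1,\dots,a_r\}$), at least one position being an OR of two or more letters. The size of an expression is the number of leaves of its tree, that is, the number of occurrences of letters. The $(\circ+,\circ|)$-intersection testing problem asks, given $\mathcal A$ of type $\circ+$ and size $m$ and $\mathcal B$ of type $\circ|$ and size $n$, whether $\mathcal L(\mathcal A)\cap\mathcal L(\mathcal B)\neq\emptyset$. The alphabet has polynomial size: for a fixed integer $c\ge 1$, all letters are non-negative integers smaller than $(m+n)^c$. Algorithms are deterministic programs for the unit-cost word RAM with word length at least a constant times the logarithm of the input size (for $k$-SAT on $n$ variables: at least a constant times $n$ plus the logarithm of the formula size, so that the memory used can be addressed). The Strong Exponential Time Hypothesis (SETH) states that for every $\varepsilon>0$ there is a $k$ such that satisfiability of formulas in conjunctive normal form with at most $k$ literals per clause and $n$ variables cannot be decided in time $O(2^{(1-\varepsilon)n})$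 times a polynomial in the size of the formula. **Theorem.** Assume SETH. Then for every $c\ge1$ and every $\alpha>0$, $(\circ+,\circ|)$-intersection testing cannot be solved in time $O((mn)^{1-\alpha})$. Moreover, there is an absolute constant $K$ such that this holds, for every $c\ge 1$ and every $\alpha>0$, even for the instances with $m\le Kn$ and $n\le Km$ only. -/

import Mathlib

/-! ## The word RAM

A word RAM with word length `w` has finitely many registers and finitely many arrays (the indices
that occur in the program text), all of which hold `w`-bit words, i.e. natural numbers below `2 ^ w`.
Arrays are addressed by words. Every elementary instruction and every test costs one step.
Programs are deterministic and do not depend on the input or on the word length. -/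

namespace WordRAM

/-- The word operations. -/
inductive Op where
  | add | sub | mul | div | mod | and | or | xor | shl | shr | eq | lt

/-- The value of a word operation at word length `w`; every result is reduced modulo `2 ^ w`.
Subtraction wraps around, comparisons return `1` or `0`, division by `0` returns `0`. -/
def Op.eval (w : ℕ) (o : Op) (x y : ℕ) : ℕ :=
  (match o with
    | .add => x + y
    | .sub => x + (2 ^ w - y % 2 ^ w)
    | .mul => x * y
    | .div => x / y
    | .mod => x % y
    | .and => Nat.land x y
    | .or => Nat.lor x y
    | .xor => Nat.xor x y
    | .shl => Nat.shiftLeft x y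
    | .shr => Nat.shiftRight x y
    | .eq => if x = y then 1 else 0
    | .lt => if x < y then 1 else 0) % 2 ^ w

/-- Programs. Registers and arrays are named by natural numbers. -/
inductive Prog where
  /-- do nothing (one step) -/
  | skip
  /-- `const r c`: register `r := c` -/
  | const (r c : ℕ)
  /-- `op o r a b`: register `r := o (register a) (register b)` -/
  | op (o : Op) (r a b : ℕ)
  /-- `load r i a`: register `r := (array i)[register a]` -/
  | load (r i a : ℕ)
  /-- `store i a b`: `(array i)[register a] := register b` -/
  | store (i a b : ℕ)
  /-- run `p`, then `q` -/
  | seq (p q : Prog)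
  /-- run `p` if register `r` is nonzero, and `q` otherwise -/
  | ite (r : ℕ) (p q : Prog)
  /-- while register `r` is nonzero, run `p` -/
  | loop (r : ℕ) (p : Prog)

/-- The content of the registers and of the arrays. -/
structure State where
  reg : ℕ → ℕ
  mem : ℕ → ℕ → ℕ

/-- Assign a value to a register. -/
def State.setReg (s : State) (r v : ℕ) : State :=
  { s with reg := Function.update s.reg r v }

/-- Assign a value to a cell of an array. -/
def State.setMem (s : State) (i a v : ℕ) : State :=
  { s with mem := Function.update s.mem i (Function.update (s.mem i) a v) }

/-- `Runs w p s t s'`: at word length `w`, the program `p` started in the state `s` halts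
after exactly `t` steps in the state `s'`. -/
inductive Runs (w : ℕ) : Prog → State → ℕ → State → Prop where
  | skip (s : State) : Runs w .skip s 1 s
  | const (s : State) (r c : ℕ) : Runs w (.const r c) s 1 (s.setReg r (c % 2 ^ w))
  | op (s : State) (o : Op) (r a b : ℕ) :
      Runs w (.op o r a b) s 1 (s.setReg r (o.eval w (s.reg a) (s.reg b)))
  | load (s : State) (r i a : ℕ) : Runs w (.load r i a) s 1 (s.setReg r (s.mem i (s.reg a)))
  | store (s : State) (i a b : ℕ) : Runs w (.store i a b) s 1 (s.setMem i (s.reg a) (s.reg b))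
  | seq {p q : Prog} {s s' s'' : State} {t t' : ℕ} :
      Runs w p s t s' → Runs w q s' t' s'' → Runs w (.seq p q) s (t + t') s''
  | ite_true {r : ℕ} {p q : Prog} {s s' : State} {t : ℕ} :
      s.reg r ≠ 0 → Runs w p s t s' → Runs w (.ite r p q) s (t + 1) s'
  | ite_false {r : ℕ} {p q : Prog} {s s' : State} {t : ℕ} :
      s.reg r = 0 → Runs w q s t s' → Runs w (.ite r p q) s (t + 1) s'
  | loop_true {r : ℕ} {p : Prog} {s s' s'' : State} {t t' : ℕ} :
      s.reg r ≠ 0 → Runs w p s t s' → Runs w (.loop r p) s' t' s'' →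
        Runs w (.loop r p) s (t + t' + 1) s''
  | loop_false {r : ℕ} {p : Prog} {s : State} : s.reg r = 0 → Runs w (.loop r p) s 1 s

/-- An input: the initial values of the first registers and the first arrays. -/
structure Input where
  regs : List ℕ
  arrays : List (List ℕ)

/-- All numbers in the input are `w`-bit words. -/
def Input.Fits (x : Input) (w : ℕ) : Prop :=
  (∀ v ∈ x.regs, v < 2 ^ w) ∧ ∀ a ∈ x.arrays, ∀ v ∈ a, v < 2 ^ w

/-- The initial state: everything outside the input is `0`. -/
def Input.init (x : Input) : State where
  reg r := x.regs.getD r 0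
  mem i j := (x.arrays.getD i []).getD j 0

/-- At word length `w`, the program `P` started on the input `x` halts after at most `T` steps,
with a nonzero value in register `0` if and only if `Q` holds. -/
def Prog.DecidesWithin (P : Prog) (w : ℕ) (x : Input) (Q : Prop) (T : ℝ) : Prop :=
  ∃ (t : ℕ) (s : State), Runs w P x.init t s ∧ (s.reg 0 ≠ 0 ↔ Q) ∧ (t : ℝ) ≤ T

end WordRAM

/-! ## The Strong Exponential Time Hypothesis -/

/-- A formula in conjunctive normal form: a list of clauses, each of them a list of literals;
the literal `(v, true)` is the variable `v` and the literal `(v, false)` is its negation. -/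
structure CNF where
  numVars : ℕ
  clauses : List (List (Fin numVars × Bool))

namespace CNF

def Satisfiable (φ : CNF) : Prop :=
  ∃ a : Fin φ.numVars → Bool, ∀ C ∈ φ.clauses, ∃ l ∈ C, a l.1 = l.2

/-- Every clause has at most `k` literals. -/
def IsKCNF (φ : CNF) (k : ℕ) : Prop :=
  ∀ C ∈ φ.clauses, C.length ≤ k

/-- The size of a formula: variables, clauses and occurrences of literals. -/
def size (φ : CNF) : ℕ :=
  φ.numVars + φ.clauses.length + φ.clauses.flatten.length

/-- A formula as an input of a word RAM: the numbers of variables, clauses and literal occurrences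
in registers, the literals (clause after clause) in one array, the clause lengths in another. -/
def toInput (φ : CNF) : WordRAM.Input where
  regs := [φ.numVars, φ.clauses.length, φ.clauses.flatten.length]
  arrays :=
    [φ.clauses.flatten.map fun l => 2 * (l.1 : ℕ) + l.2.toNat,
     φ.clauses.map List.length]

end CNF

/-- `k`-SAT is solvable in time `2 ^ ((1 - ε) n)` times a polynomial in the size of the formula, where
`n` is the number of variables. The word length only has to be at least a constant `κ` times
`n + log (size)`, so that the memory used can be addressed. -/
def KSATSolvable (k : ℕ) (ε : ℝ) : Prop :=
  ∃ (P : WordRAM.Prog) (κ c : ℕ) (D : ℝ), ∀ φ : CNF, φ.IsKCNF k →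
    ∀ w : ℕ, (2 ^ φ.numVars * (φ.size + 2)) ^ κ ≤ 2 ^ w → φ.toInput.Fits w →
      P.DecidesWithin w φ.toInput φ.Satisfiable
        (D * (2 : ℝ) ^ ((1 - ε) * (φ.numVars : ℝ)) * ((φ.size : ℝ) + 2) ^ c)

/-- The Strong Exponential Time Hypothesis: for every `ε > 0` there is a `k` such that `k`-SAT on `n`
variables cannot be solved in time `2 ^ ((1 - ε) n)`, up to polynomial factors. -/
def SETH : Prop :=
  ∀ ε : ℝ, 0 < ε → ∃ k : ℕ, ¬ KSATSolvable k ε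

/-! ## Regular expressions of type `∘+` and `∘|` -/

/-- A concatenation of positions, each of them a letter `a`, written `(a, false)`, or `a⁺`,
written `(a, true)`. Letters are natural numbers. -/
structure ConcatPlus where
  positions : List (ℕ × Bool)

namespace ConcatPlus

/-- The language of one position: `{a}`, or `{aᵏ : k ≥ 1}`. -/
def positionLanguage : ℕ × Bool → Language ℕ
  | (a, false) => {[a]}
  | (a, true) => {u | ∃ k : ℕ, 1 ≤ k ∧ u = List.replicate k a}

/-- The language of the expression: the product of the languages of its positions. -/
def language (A : ConcatPlus) : Language ℕ :=
  (A.positions.map positionLanguage).prod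

/-- The number of leaves of the expression tree. -/
def size (A : ConcatPlus) : ℕ :=
  A.positions.length

/-- Some `+` occurs, so that the depth is two rather than one (a plain string).
In particular there is at least one position. -/
def HasDepthTwo (A : ConcatPlus) : Prop :=
  ∃ p ∈ A.positions, p.2 = true

/-- All letters are smaller than `σ`. -/
def LettersBelow (A : ConcatPlus) (σ : ℕ) : Prop :=
  ∀ p ∈ A.positions, p.1 < σ

end ConcatPlus

/-- A concatenation of positions, each of them an OR of letters, given as the list of these letters;
a position with one letter is that letter. -/
structure ConcatOr where
  positions : List (List ℕ)

namespace ConcatOr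

/-- The language of one position: the letters that occur in it, as strings of length one. -/
def positionLanguage (S : List ℕ) : Language ℕ :=
  {u | ∃ a ∈ S, u = [a]}

/-- The language of the expression: the product of the languages of its positions. -/
def language (B : ConcatOr) : Language ℕ :=
  (B.positions.map positionLanguage).prod

/-- The number of leaves of the expression tree. -/
def size (B : ConcatOr) : ℕ :=
  B.positions.flatten.length

/-- Every position has a letter, and the depth is two rather than one (a plain string):
some OR of at least two letters occurs. -/
def HasDepthTwo (B : ConcatOr) : Prop :=
  (∀ S ∈ B.positions, S ≠ []) ∧ ∃ S ∈ B.positions, 2 ≤ S.length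

/-- All letters are smaller than `σ`. -/
def LettersBelow (B : ConcatOr) (σ : ℕ) : Prop :=
  ∀ S ∈ B.positions, ∀ a ∈ S, a < σ

end ConcatOr

/-! ## Intersection testing -/

/-- A pair of expressions as an input of a word RAM. Registers: the two sizes and the number of
positions of `B`. Arrays: the letters of `A`, its `+` flags, the leaves of `B` from left to right, and
the numbers of letters in the positions of `B`. -/
def intersectionInput (A : ConcatPlus) (B : ConcatOr) : WordRAM.Input where
  regs := [A.size, B.size, B.positions.length]
  arrays :=
    [A.positions.map Prod.fst,
     A.positions.map fun p => p.2.toNat,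
     B.positions.flatten,
     B.positions.map List.length]

/-- Some word RAM program solves `(∘+, ∘|)`-intersection testing in time `O(T m n)`, where `m` and `n`
are the sizes of the two expressions, on all instances whose sizes satisfy `R m n` and whose letters
are integers below `(m + n) ^ c`. The word length only has to be at least a constant `κ` times
`log (m + n)` and large enough for the input. -/
def IntersectionTestingSolvable (c : ℕ) (R : ℕ → ℕ → Prop) (T : ℕ → ℕ → ℝ) : Prop :=
  ∃ (P : WordRAM.Prog) (κ : ℕ) (D : ℝ), ∀ (A : ConcatPlus) (B : ConcatOr),
    A.HasDepthTwo → B.HasDepthTwo →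
    A.LettersBelow ((A.size + B.size) ^ c) → B.LettersBelow ((A.size + B.size) ^ c) →
    R A.size B.size →
    ∀ w : ℕ, (A.size + B.size) ^ κ ≤ 2 ^ w → (intersectionInput A B).Fits w →
      P.DecidesWithin w (intersectionInput A B) (∃ u, u ∈ A.language ∧ u ∈ B.language)
        (D * T A.size B.size)

/-! The proof splits the variables and reduces `k`-SAT to intersection testing. With `h = ⌈n/2⌉` and
`N = 2 ^ h`, let `i` and `j` range over the assignments of the two halves of the variables, and let
`sat₁ i r` and `sat₂ j r` say that the respective half assignment makes clause `r` true. The formula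
is satisfiable iff some pair `(i, j)` covers every clause (`satisfiable_iff`). Two expressions of
size `O(N (d + 2))`, where `d` is the number of clauses, search all `N²` pairs at once.

Write `W = d + 2`. The first expression has one group `y⁺ a₁ … a_d z⁺` per `i`; the second has `3N`
blocks of `W` positions, of which only the middle `N`, one per `j`, constrain anything. A letter is
twice its coordinate in the group, plus `1` for an unsatisfied clause. A block position admits the
even letter of its coordinate, and the odd one if its block is universal or `sat₂` holds. In
addition `y = 0` is admitted before the last middle position, and `z = 2 (d + 1)` after the first
one. For a covering pair, the groups before `i` are matched one to one with universal blocks, `y⁺`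
of group `i` stretches up to block `j`, `z⁺` stretches into the last universal part, and the other
groups follow one to one (`intersection_complete`). Conversely, the first middle position can only
be read by some `y` and the last one only by some `z`, so that a whole word `a₁ … a_d` lies between
them; its letters carry their coordinates, so it is aligned with one block (`intersection_sound`).

The rest is quantitative. A word RAM program writes the instance in time `2 ^ (n/2)` times a
polynomial (`reductionProg_halts`), and the assumed solver then runs on it with its registers and
arrays renamed (`Runs.shift`, `tail_eq_init`). Since `m n` is `2 ^ n` up to polynomial factors, time
`(m n) ^ (1 - α)` becomes `2 ^ ((1 - ε) n)` times a polynomial (`product_rpow_le`), with `ε = min α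
(1/2)` because building the instance costs `2 ^ (n/2)` anyway. This contradicts SETH. -/

namespace ConcatPlus

/-! ### Membership in the two kinds of languages -/

/-- A word belongs to the language of `A` iff it splits into one run per position;
`c x` is the place where the run of position `x` starts. -/
theorem mem_language_iff (P : List (ℕ × Bool)) (u : List ℕ) :
    u ∈ (P.map positionLanguage).prod ↔
      ∃ c : ℕ → ℕ, c 0 = 0 ∧ c P.length = u.length ∧
        ∀ (x : ℕ) (hx : x < P.length), c x < c (x + 1) ∧
          ((P[x]).2 = false → c (x + 1) = c x + 1) ∧
          ∀ t, c x ≤ t → t < c (x + 1) → u[t]? = some (P[x]).1 := by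
  induction P generalizing u with
  | nil =>
    simp only [List.map_nil, List.prod_nil, Language.mem_one, List.length_nil]
    constructor
    · rintro rfl
      exact ⟨fun _ => 0, by simp⟩
    · rintro ⟨c, h0, h1, -⟩
      exact List.length_eq_zero_iff.1 (h1.symm.trans h0)
  | cons p P ih =>
    have hpos : ∀ w : List ℕ, w ∈ positionLanguage p ↔
        ∃ k, 1 ≤ k ∧ (p.2 = false → k = 1) ∧ w = List.replicate k p.1 := by
      intro w
      rcases p with ⟨a, _ | _⟩
      · constructor
        · intro h
          exact ⟨1, le_rfl, fun _ => rfl, h⟩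
        · rintro ⟨k, -, hk, rfl⟩
          rw [hk rfl]
          exact rfl
      · constructor
        · rintro ⟨k, hk, rfl⟩
          exact ⟨k, hk, by simp, rfl⟩
        · rintro ⟨k, hk, -, rfl⟩
          exact ⟨k, hk, rfl⟩
    rw [List.map_cons, List.prod_cons, Language.mem_mul]
    constructor
    · rintro ⟨w, hw, v, hv, rfl⟩
      obtain ⟨k, hk, hk1, rfl⟩ := (hpos w).1 hw
      obtain ⟨c, h0, h1, hc⟩ := (ih v).1 hv
      -- The runs of the remaining positions are moved right by the length `k` of the first run.
      refine ⟨fun x => if x = 0 then 0 else k + c (x - 1), by simp, by simp [h1], ?_⟩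
      rintro (_ | x) hx
      · refine ⟨by simp [h0]; omega, by simpa [h0] using hk1, ?_⟩
        intro t _ ht
        have ht' : t < k := by simpa [h0] using ht
        rw [List.getElem?_append_left (by simpa using ht')]
        simp [ht']
      · obtain ⟨hlt, hf, hl⟩ := hc x (by simpa using hx)
        refine ⟨by simpa using hlt, fun h => ?_, ?_⟩
        · have := hf (by simpa using h)
          simp
          omega
        · intro t ht ht'
          simp at ht ht'
          rw [List.getElem?_append_right (by simp; omega)]
          simpa using hl (t - k) (by omega) (by omega)
    · rintro ⟨c, h0, h1, hc⟩
      obtain ⟨hlt, hf, hl⟩ := hc 0 (by simp)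
      have hmono : ∀ x, x ≤ P.length → c 1 ≤ c (x + 1) := by
        intro x
        induction x with
        | zero => simp
        | succ x ihx =>
          intro h
          have := (hc (x + 1) (by simp; omega)).1
          have := ihx (by omega)
          omega
      have hle : c 1 ≤ u.length := by
        rw [← h1]
        exact hmono _ le_rfl
      rw [h0, zero_add] at *
      refine ⟨u.take (c 1), ?_, u.drop (c 1), ?_, List.take_append_drop _ _⟩
      · refine (hpos _).2 ⟨c 1, hlt, by simpa [h0] using hf, ?_⟩
        apply List.ext_getElem?
        intro t
        by_cases ht : t < c 1
        · rw [List.getElem?_take_of_lt ht, hl t (by omega) ht]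
          simp [ht]
        · rw [List.getElem?_eq_none (by simp; omega), List.getElem?_eq_none (by simp; omega)]
      · refine (ih _).2 ⟨fun x => c (x + 1) - c 1, by simp, ?_, ?_⟩
        · simp [← h1]
        · intro x hx
          obtain ⟨g1, g2, g3⟩ := hc (x + 1) (by simpa using hx)
          have := hmono x hx.le
          dsimp only
          refine ⟨by omega, fun h => ?_, ?_⟩
          · have := g2 (by simpa using h)
            omega
          · intro t ht ht'
            rw [List.getElem?_drop]
            simpa using g3 (c 1 + t) (by omega) (by omega)

end ConcatPlus

namespace ConcatOr

theorem mem_language_iff (P : List (List ℕ)) (u : List ℕ) :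
    u ∈ (P.map positionLanguage).prod ↔ List.Forall₂ (· ∈ ·) u P := by
  induction P generalizing u with
  | nil => simp [Language.mem_one]
  | cons S P ih =>
    rw [List.map_cons, List.prod_cons, Language.mem_mul]
    constructor
    · rintro ⟨_, ⟨a, ha, rfl⟩, v, hv, rfl⟩
      exact List.Forall₂.cons ha ((ih v).1 hv)
    · intro h
      rcases h with _ | ⟨ha, hv⟩
      exact ⟨_, ⟨_, ha, rfl⟩, _, (ih _).2 hv, rfl⟩

end ConcatOr

/-! ## The expressions of the reduction -/

namespace Reduction

/-- Is the position `x` of the first expression a `+`? -/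
def plusFlag (d x : ℕ) : Bool :=
  decide (x % (d + 2) = 0) || decide (x % (d + 2) = d + 1)

/-- The letter at position `x` of the first expression. -/
def plusLetter (d : ℕ) (sat : ℕ → ℕ → Bool) (x : ℕ) : ℕ :=
  x % (d + 2) + x % (d + 2) +
    (if (sat (x / (d + 2)) (x % (d + 2)) || plusFlag d x) = true then 0 else 1)

/-- `N` groups `y⁺ a₁ … a_d z⁺`, where `aᵣ` tells whether `sat i r` holds. -/
def plusExpr (N d : ℕ) (sat : ℕ → ℕ → Bool) : ConcatPlus where
  positions := (List.range (N * (d + 2))).map fun x => (plusLetter d sat x, plusFlag d x)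

/-- Does the position `p` of the second expression admit both letters of its coordinate? -/
def orWild (N d : ℕ) (sat : ℕ → ℕ → Bool) (p : ℕ) : Bool :=
  sat (p / (d + 2) - N) (p % (d + 2)) ||
    (decide (p < N * (d + 2)) || decide (2 * (N * (d + 2)) ≤ p))

/-- The letters at position `p` of the second expression. -/
def orLetters (N d : ℕ) (sat : ℕ → ℕ → Bool) (p : ℕ) : List ℕ :=
  [p % (d + 2) + p % (d + 2),
    p % (d + 2) + p % (d + 2) + (if orWild N d sat p = true then 1 else 0),
    if p + 1 < 2 * (N * (d + 2)) then 0 else p % (d + 2) + p % (d + 2),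
    if N * (d + 2) < p then 2 * (d + 1) else p % (d + 2) + p % (d + 2)]

/-- `N` universal blocks, `N` blocks for the values of `sat`, and `N` universal blocks. -/
def orExpr (N d : ℕ) (sat : ℕ → ℕ → Bool) : ConcatOr where
  positions := (List.range (3 * (N * (d + 2)))).map (orLetters N d sat)

variable {N d : ℕ} {sat₁ sat₂ : ℕ → ℕ → Bool}

/-! ### Common words correspond to covering pairs -/

theorem mem_orExpr_language (u : List ℕ) :
    u ∈ (orExpr N d sat₂).language ↔ u.length = 3 * (N * (d + 2)) ∧
      ∀ p (hp : p < u.length), u[p] ∈ orLetters N d sat₂ p := by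
  rw [ConcatOr.language, ConcatOr.mem_language_iff, List.forall₂_iff_get]
  simp only [orExpr, List.length_map, List.length_range, List.get_eq_getElem, List.getElem_map,
    List.getElem_range]
  constructor
  · rintro ⟨h, h'⟩
    exact ⟨h, fun p hp => h' p hp (h ▸ hp)⟩
  · rintro ⟨h, h'⟩
    exact ⟨h, fun p hp _ => h' p hp⟩

theorem mem_plusExpr_language (u : List ℕ) :
    u ∈ (plusExpr N d sat₁).language ↔
      ∃ c : ℕ → ℕ, c 0 = 0 ∧ c (N * (d + 2)) = u.length ∧
        ∀ x < N * (d + 2), c x < c (x + 1) ∧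
          (plusFlag d x = false → c (x + 1) = c x + 1) ∧
          ∀ t, c x ≤ t → t < c (x + 1) → u[t]? = some (plusLetter d sat₁ x) := by
  rw [ConcatPlus.language, ConcatPlus.mem_language_iff]
  simp [plusExpr]

/-- A monotone step function passes every value below its end. -/
theorem exists_run {c : ℕ → ℕ} {n t : ℕ} (h0 : c 0 = 0) (ht : t < c n) :
    ∃ x < n, c x ≤ t ∧ t < c (x + 1) := by
  induction n with
  | zero => omega
  | succ n ih =>
    by_cases h : t < c n
    · obtain ⟨x, hx, h'⟩ := ih h
      exact ⟨x, by omega, h'⟩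
    · exact ⟨n, by omega, by omega, ht⟩

/-- Odd letters come only from single-letter positions with an unsatisfied clause; halving a letter
always recovers the coordinate. -/
theorem plusLetter_cases (x : ℕ) :
    plusLetter d sat₁ x = 2 * (x % (d + 2)) ∨ plusFlag d x = false ∧
      sat₁ (x / (d + 2)) (x % (d + 2)) = false ∧ plusLetter d sat₁ x = 2 * (x % (d + 2)) + 1 := by
  unfold plusLetter
  cases plusFlag d x <;> cases sat₁ (x / (d + 2)) (x % (d + 2)) <;> simp <;> omega

theorem plusFlag_eq_false {x : ℕ} :
    plusFlag d x = false ↔ x % (d + 2) ≠ 0 ∧ x % (d + 2) ≠ d + 1 := by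
  simp [plusFlag]

/-- Two positions of the word pin down a group: `N * W`, where `z` is not yet admitted, and `2 * (N
* W) - 1`, where `y` no longer is. Between the runs that cover them lies the rigid part `a₁ … a_d`
of some group. -/
theorem intersection_sound (hN : 0 < N) {u : List ℕ} (hA : u ∈ (plusExpr N d sat₁).language)
    (hB : u ∈ (orExpr N d sat₂).language) :
    ∃ i < N, ∃ j < N, ∀ r, 1 ≤ r → r ≤ d → sat₁ i r = true ∨ sat₂ j r = true := by
  obtain ⟨c, h0, h1, hc⟩ := (mem_plusExpr_language u).1 hA
  obtain ⟨hlen, hmem⟩ := (mem_orExpr_language u).1 hB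
  set W := d + 2 with hW
  have hNW : W ≤ N * W := Nat.le_mul_of_pos_left _ hN
  have hmono : ∀ x y, x ≤ y → y ≤ N * W → c x ≤ c y := by
    intro x y hxy
    induction y, hxy using Nat.le_induction with
    | base => simp
    | succ y hy ih =>
      intro h
      have := (hc y (by omega)).1
      have := ih (by omega)
      omega
  have hletter : ∀ x < N * W, ∀ t, c x ≤ t → t < c (x + 1) → t < u.length →
      plusLetter d sat₁ x ∈ orLetters N d sat₂ t := by
    intro x hx t h h' ht
    have := (hc x hx).2.2 t h h'
    rw [List.getElem?_eq_getElem ht, Option.some_inj] at this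
    rw [← this]
    exact hmem t ht
  obtain ⟨x, hx, hx1, hx2⟩ := exists_run (t := N * W) h0 (by rw [h1]; omega)
  obtain ⟨x', hx', hx1', hx2'⟩ := exists_run (t := 2 * (N * W) - 1) h0 (by rw [h1]; omega)
  -- The letters available at `N * W` are `0` and possibly `1`. The letter `1` would need a position
  -- of coordinate `0` that is not a `+`.
  have hxr : x % W = 0 := by
    have := hletter x hx _ hx1 hx2 (by omega)
    rcases plusLetter_cases (d := d) (sat₁ := sat₁) x with h | ⟨h, -, h'⟩
    · rw [h] at this
      simp only [orLetters, List.mem_cons, ← hW, Nat.mul_mod_left] at this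
      split_ifs at this <;> simp at this <;> omega
    · rw [h'] at this
      rw [plusFlag_eq_false] at h
      simp only [orLetters, List.mem_cons, ← hW, Nat.mul_mod_left] at this
      split_ifs at this <;> simp at this <;> omega
  have hmod : (2 * (N * W) - 1) % W = d + 1 := by
    have : 2 * (N * W) - 1 = (d + 1) + W * (2 * N - 1) := by
      obtain ⟨N, rfl⟩ : ∃ m, N = m + 1 := ⟨N - 1, by omega⟩
      have : 2 * (N + 1) - 1 = 2 * N + 1 := by omega
      rw [this, hW]
      have : 2 * ((N + 1) * (d + 2)) = (d + 1 + (d + 2) * (2 * N + 1)) + 1 := by ring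
      omega
    rw [this, Nat.add_mul_mod_self_left, Nat.mod_eq_of_lt (by omega)]
  have hxr' : x' % W = d + 1 := by
    have := hletter x' hx' _ hx1' hx2' (by omega)
    have hlt : x' % W < W := Nat.mod_lt _ (by omega)
    rcases plusLetter_cases (d := d) (sat₁ := sat₁) x' with h | ⟨h, -, h'⟩
    · rw [h] at this
      simp only [orLetters, List.mem_cons, ← hW, hmod] at this
      split_ifs at this <;> simp at this <;> omega
    · rw [h'] at this
      rw [plusFlag_eq_false] at h
      simp only [orLetters, List.mem_cons, ← hW, hmod] at this
      split_ifs at this <;> simp at this <;> omega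
  have hxx : x < x' := by
    rcases Nat.lt_or_ge x x' with h | h
    · exact h
    · rcases Nat.lt_or_ge x' x with h' | h'
      · have := hmono (x' + 1) x (by omega) hx.le
        omega
      · have : x = x' := by omega
        subst this
        omega
  -- `x` opens a group and `x'` closes one that is not earlier, so the group of `x` is finished by
  -- the time `x'` is reached.
  have hx'W : x + (d + 1) ≤ x' := by
    have e1 := Nat.div_add_mod x W
    have e2 := Nat.div_add_mod x' W
    have : x / W ≤ x' / W := Nat.div_le_div_right hxx.le
    have := Nat.mul_le_mul_left W this
    omega
  have hr : ∀ k, k ≤ d + 1 → (x + k) % W = k ∧ (x + k) / W = x / W := by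
    intro k hk
    have e1 := Nat.div_add_mod x W
    have : x + k = k + W * (x / W) := by omega
    constructor
    · rw [this, Nat.add_mul_mod_self_left, Nat.mod_eq_of_lt (by omega)]
    · conv_lhs => rw [this]
      rw [Nat.add_mul_div_left _ _ (by omega), Nat.div_eq_of_lt (by omega), zero_add]
  have hck : ∀ k, k ≤ d → c (x + 1 + k) = c (x + 1) + k := by
    intro k
    induction k with
    | zero => simp
    | succ k ih =>
      intro hk
      have := (hc (x + 1 + k) (by omega)).2.1 (by
        rw [plusFlag_eq_false, ← hW, show x + 1 + k = x + (k + 1) by omega, (hr _ (by omega)).1]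
        omega)
      rw [← add_assoc (x + 1), this, ih (by omega)]
      omega
  have hend : c (x + 1) + d ≤ 2 * (N * W) - 1 := by
    rw [← hck d le_rfl]
    have := hmono (x + 1 + d) x' (by omega) hx'.le
    omega
  -- As `1 ≤ k + 1 ≤ d`, the letter is neither `y` nor `z`, so only the first two entries of
  -- `orLetters` can match: the coordinates agree, and an odd letter forces `sat₂`, since the
  -- position is outside the universal parts.
  have hcoord : ∀ k, k < d → (c (x + 1) + k) % W = k + 1 ∧
      (sat₁ (x / W) (k + 1) = true ∨ sat₂ ((c (x + 1) + k) / W - N) (k + 1) = true) := by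
    intro k hk
    have hk1 := hck k (by omega)
    have hk2 := hck (k + 1) (by omega)
    obtain ⟨r1, r2⟩ := hr (k + 1) (by omega)
    have := hletter (x + 1 + k) (by omega) (c (x + 1) + k) (by omega)
      (by rw [add_assoc (x + 1), hk2]; omega) (by omega)
    rw [add_assoc, add_comm 1 k] at this
    rcases plusLetter_cases (d := d) (sat₁ := sat₁) (x + (k + 1)) with h | ⟨-, h, h'⟩
    · have hs : sat₁ (x / W) (k + 1) = true := by
        by_contra hs
        have hf : plusFlag d (x + (k + 1)) = false := by
          rw [plusFlag_eq_false, ← hW, r1]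
          omega
        simp [plusLetter, ← hW, r1, r2, hs, hf] at h
        omega
      rw [h, ← hW, r1] at this
      refine ⟨?_, Or.inl hs⟩
      simp only [orLetters, List.mem_cons, ← hW] at this
      split_ifs at this <;> simp at this <;> omega
    · rw [h', ← hW, r1] at this
      have hd1 : ¬ c (x + 1) + k < N * W := by omega
      have hd2 : ¬ 2 * (N * W) ≤ c (x + 1) + k := by omega
      simp only [orLetters, List.mem_cons, ← hW, orWild, decide_eq_false hd1,
        decide_eq_false hd2, Bool.or_false] at this
      split_ifs at this with h1 <;> simp at this
      all_goals first
        | (have e : (c (x + 1) + k) % W = k + 1 := by omega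
           refine ⟨e, Or.inr ?_⟩
           rwa [e] at h1)
        | (exfalso; omega)
  have hN' : x / W < N := Nat.div_lt_of_lt_mul (by rwa [mul_comm])
  -- Without clauses any `j` will do. Otherwise `a₁` fixes the alignment, and all of `a₁ … a_d`
  -- falls into the block of `c (x + 1)`.
  rcases Nat.eq_zero_or_pos d with hd | hd
  · exact ⟨x / W, hN', 0, hN, fun r h h' => by omega⟩
  · refine ⟨x / W, hN', c (x + 1) / W - N, ?_, ?_⟩
    · have : c (x + 1) / W < 2 * N := Nat.div_lt_of_lt_mul (by
        rw [mul_comm, mul_assoc]; omega)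
      omega
    · intro r h h'
      obtain ⟨k, rfl⟩ : ∃ k, r = k + 1 := ⟨r - 1, by omega⟩
      have := (hcoord k (by omega)).2
      have e : (c (x + 1) + k) / W = c (x + 1) / W := by
        have e1 := Nat.div_add_mod (c (x + 1)) W
        have e2 := (hcoord 0 hd).1
        simp only [add_zero] at e2
        have : c (x + 1) + k = (k + 1) + W * (c (x + 1) / W) := by omega
        conv_lhs => rw [this]
        rw [Nat.add_mul_div_left _ _ (by omega), Nat.div_eq_of_lt (by omega), zero_add]
      rwa [e] at this

/-- An explicit placement of the runs works: the two `+` of group `i` absorb a shift by `N + j - i`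
blocks and then one by `N - j + i` blocks, a total of `2N` whatever `i` and `j` are. -/
theorem intersection_complete {i j : ℕ} (hi : i < N) (hj : j < N)
    (h : ∀ r, 1 ≤ r → r ≤ d → sat₁ i r = true ∨ sat₂ j r = true) :
    ∃ u, u ∈ (plusExpr N d sat₁).language ∧ u ∈ (orExpr N d sat₂).language := by
  have hiN : i * (d + 2) + (d + 2) ≤ N * (d + 2) := by
    have := Nat.mul_le_mul_right (d + 2) (show i + 1 ≤ N from hi)
    rwa [add_mul, one_mul] at this
  have hjN : j * (d + 2) + (d + 2) ≤ N * (d + 2) := by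
    have := Nat.mul_le_mul_right (d + 2) (show j + 1 ≤ N from hj)
    rwa [add_mul, one_mul] at this
  obtain ⟨W, hW⟩ : ∃ W, W = d + 2 := ⟨_, rfl⟩
  rw [← hW] at hiN hjN
  let c : ℕ → ℕ := fun x => if x ≤ i * W then x else
    if x < i * W + W then x - i * W + (N * W + j * W) else 2 * (N * W) + x
  have hcd : ∀ x, c x = if x ≤ i * W then x else
    if x < i * W + W then x - i * W + (N * W + j * W) else 2 * (N * W) + x := fun _ => rfl
  have hlt : ∀ x, c x < c (x + 1) := by
    intro x
    rw [hcd, hcd]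
    split_ifs <;> omega
  have hmono : StrictMono c := strictMono_nat_of_lt_succ hlt
  have h0 : c 0 = 0 := by simp [hcd]
  have hend : c (N * W) = 3 * (N * W) := by
    rw [hcd]
    split_ifs <;> omega
  -- The implication is placed inside the existential so that `choose` yields a function `f` on all
  -- positions, giving the run that contains `t`.
  have hrun : ∀ t, ∃ x, t < 3 * (N * W) → x < N * W ∧ c x ≤ t ∧ t < c (x + 1) := by
    intro t
    by_cases ht : t < 3 * (N * W)
    · obtain ⟨x, hx⟩ := exists_run (t := t) h0 (by rwa [hend])
      exact ⟨x, fun _ => hx⟩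
    · exact ⟨0, fun h => absurd h ht⟩
  choose f hf using hrun
  refine ⟨(List.range (3 * (N * W))).map fun t => plusLetter d sat₁ (f t), ?_, ?_⟩
  · rw [mem_plusExpr_language, ← hW]
    refine ⟨c, h0, by simpa using hend, fun x hx => ⟨hlt x, fun hr => ?_, fun t ht ht' => ?_⟩⟩
    · rw [plusFlag_eq_false, ← hW] at hr
      have h1 : x ≠ i * W := by
        rintro rfl
        simp at hr
      have h2 : x ≠ i * W + (d + 1) := by
        rintro rfl
        rw [Nat.mul_add_mod_self_right, Nat.mod_eq_of_lt (by omega)] at hr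
        omega
      rw [hcd, hcd]
      split_ifs <;> omega
    · have htl : t < 3 * (N * W) := by
        rw [← hend]
        exact ht'.trans_le (hmono.monotone hx)
      obtain ⟨-, g1, g2⟩ := hf t htl
      have e1 := hmono.lt_iff_lt.1 (g1.trans_lt ht')
      have e2 := hmono.lt_iff_lt.1 (ht.trans_lt g2)
      have : f t = x := by omega
      simp [htl, this]
  · rw [mem_orExpr_language, ← hW]
    refine ⟨by simp, fun t ht => ?_⟩
    simp only [List.length_map, List.length_range] at ht
    simp only [List.getElem_map, List.getElem_range]
    obtain ⟨g0, g1, g2⟩ := hf t ht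
    generalize f t = x at g0 g1 g2
    have hWpos : 0 < W := by omega
    -- Covers all runs outside group `i`: there each position of the word has the coordinate of its
    -- run and lies in a universal block.
    have hwild : x % W = t % W → (t < N * W ∨ 2 * (N * W) ≤ t) →
        plusLetter d sat₁ x ∈ orLetters N d sat₂ t := by
      intro e ht
      rcases plusLetter_cases (d := d) (sat₁ := sat₁) x with hl | ⟨-, -, hl⟩ <;>
        rw [hl] <;> simp [orLetters, orWild, ← hW, e, ht] <;> omega
    rcases Nat.lt_or_ge x (i * W) with hx | hx
    · have e : t = x := by
        rw [hcd, if_pos hx.le] at g1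
        rw [hcd, if_pos (show x + 1 ≤ i * W from hx)] at g2
        omega
      subst e
      exact hwild rfl (Or.inl g0)
    rcases Nat.lt_or_ge x (i * W + W) with hx' | hx'
    · obtain ⟨r, rfl⟩ := Nat.exists_eq_add_of_le hx
      have hr : r < W := by omega
      have er : (i * W + r) % W = r := by
        rw [Nat.mul_add_mod_self_right, Nat.mod_eq_of_lt hr]
      have eq : (i * W + r) / W = i := by
        rw [Nat.mul_comm, Nat.mul_add_div hWpos, Nat.div_eq_of_lt hr, add_zero]
      rcases Nat.eq_zero_or_pos r with h0 | h0
      · subst h0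
        have : t + 1 < 2 * (N * W) := by
          rw [hcd, if_neg (by omega), if_pos (by omega)] at g2
          omega
        simp [orLetters, plusLetter, plusFlag, ← hW, this]
      rcases Nat.lt_or_ge d r with hd | hd
      · have e : r = d + 1 := by omega
        have : N * W < t := by
          rw [hcd, if_neg (by omega), if_pos (by omega)] at g1
          omega
        rcases plusLetter_cases (d := d) (sat₁ := sat₁) (i * W + r) with hl | ⟨hl, -⟩
        · rw [hl, ← hW, er, e]
          simp [orLetters, ← hW, this]
        · rw [plusFlag_eq_false, ← hW, er] at hl
          omega
      · have e : t = W * (N + j) + r := by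
          rw [hcd, if_neg (by omega), if_pos (by omega)] at g1 g2
          have : W * (N + j) = N * W + j * W := by ring
          omega
        have e1 : t % W = r := by rw [e, Nat.mul_add_mod, Nat.mod_eq_of_lt hr]
        have e2 : t / W - N = j := by
          rw [e, Nat.mul_add_div hWpos, Nat.div_eq_of_lt hr]
          omega
        rcases plusLetter_cases (d := d) (sat₁ := sat₁) (i * W + r) with hl | ⟨-, hs, hl⟩
        · rw [hl]
          simp [orLetters, ← hW, er, e1]
          omega
        · rw [← hW, er, eq] at hs
          have := (h r h0 hd).resolve_left (by simp [hs])
          rw [hl]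
          simp [orLetters, orWild, ← hW, er, e1, e2, this]
          omega
    · have e : t = 2 * (N * W) + x := by
        rw [hcd, if_neg (by omega), if_neg (by omega)] at g1
        rw [hcd, if_neg (by omega), if_neg (by omega)] at g2
        omega
      refine hwild ?_ (Or.inr (by omega))
      rw [e, ← mul_assoc, Nat.mul_add_mod_self_right]

theorem intersection_iff (hN : 0 < N) :
    (∃ u, u ∈ (plusExpr N d sat₁).language ∧ u ∈ (orExpr N d sat₂).language) ↔
      ∃ i < N, ∃ j < N, ∀ r, 1 ≤ r → r ≤ d → sat₁ i r = true ∨ sat₂ j r = true :=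
  ⟨fun ⟨_, hA, hB⟩ => intersection_sound hN hA hB,
    fun ⟨_, hi, _, hj, h⟩ => intersection_complete hi hj h⟩

end Reduction

namespace WordRAM

/-! ### Reasoning about programs -/

/-- Started in `s`, the program halts within `T` steps in a state that satisfies `Q`. -/
def Halts (w : ℕ) (p : Prog) (s : State) (T : ℕ) (Q : State → Prop) : Prop :=
  ∃ t s', Runs w p s t s' ∧ t ≤ T ∧ Q s'

/-- May the program write to the register `r`? -/
def Prog.writesReg (r : ℕ) : Prog → Bool
  | .skip => false
  | .const r' _ => r == r'
  | .op _ r' _ _ => r == r'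
  | .load r' _ _ => r == r'
  | .store _ _ _ => false
  | .seq p q => p.writesReg r || q.writesReg r
  | .ite _ p q => p.writesReg r || q.writesReg r
  | .loop _ p => p.writesReg r

/-- May the program write to the array `i`? -/
def Prog.writesMem (i : ℕ) : Prog → Bool
  | .skip => false
  | .const _ _ => false
  | .op _ _ _ _ => false
  | .load _ _ _ => false
  | .store i' _ _ => i == i'
  | .seq p q => p.writesMem i || q.writesMem i
  | .ite _ p q => p.writesMem i || q.writesMem i
  | .loop _ p => p.writesMem i

variable {w : ℕ} {p q : Prog} {s s' : State} {t T T' : ℕ} {Q R : State → Prop}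

/-- The criterion is syntactic, so for concrete programs `decide` shows that a register survives. -/
theorem Runs.reg_eq (h : Runs w p s t s') {r : ℕ} (hr : p.writesReg r = false) :
    s'.reg r = s.reg r := by
  induction h with
  | skip | store | loop_false => rfl
  | const | op | load =>
    simp only [Prog.writesReg, beq_eq_false_iff_ne] at hr
    simp [State.setReg, hr]
  | seq _ _ ih ih' =>
    simp only [Prog.writesReg, Bool.or_eq_false_iff] at hr
    rw [ih' hr.2, ih hr.1]
  | ite_true _ _ ih =>
    simp only [Prog.writesReg, Bool.or_eq_false_iff] at hr
    exact ih hr.1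
  | ite_false _ _ ih =>
    simp only [Prog.writesReg, Bool.or_eq_false_iff] at hr
    exact ih hr.2
  | loop_true _ _ _ ih ih' => rw [ih' hr, ih hr]

theorem Runs.mem_eq (h : Runs w p s t s') {i : ℕ} (hi : p.writesMem i = false) :
    s'.mem i = s.mem i := by
  induction h with
  | skip | const | op | load | loop_false => rfl
  | store =>
    simp only [Prog.writesMem, beq_eq_false_iff_ne] at hi
    simp [State.setMem, hi]
  | seq _ _ ih ih' =>
    simp only [Prog.writesMem, Bool.or_eq_false_iff] at hi
    rw [ih' hi.2, ih hi.1]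
  | ite_true _ _ ih =>
    simp only [Prog.writesMem, Bool.or_eq_false_iff] at hi
    exact ih hi.1
  | ite_false _ _ ih =>
    simp only [Prog.writesMem, Bool.or_eq_false_iff] at hi
    exact ih hi.2
  | loop_true _ _ _ ih ih' => rw [ih' hi, ih hi]

@[simp] theorem State.setReg_reg (s : State) (r v x : ℕ) :
    (s.setReg r v).reg x = if x = r then v else s.reg x := by
  simp [State.setReg, Function.update_apply]

@[simp] theorem State.setReg_mem (s : State) (r v : ℕ) : (s.setReg r v).mem = s.mem := rfl

@[simp] theorem State.setMem_reg (s : State) (i a v : ℕ) : (s.setMem i a v).reg = s.reg := rfl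

@[simp] theorem State.setMem_mem (s : State) (i a v x : ℕ) :
    (s.setMem i a v).mem x = if x = i then Function.update (s.mem i) a v else s.mem x := by
  by_cases h : x = i
  · subst h
    simp [State.setMem]
  · simp [State.setMem, h]

/-- Run the programs of a list one after the other. -/
def Prog.block : List Prog → Prog
  | [] => .skip
  | p :: l => .seq p (block l)

variable {l : List Prog} {o : Op} {r a b i v x y c n u : ℕ}

namespace Halts

/-- Registers and arrays that do not occur as targets keep their contents. -/
theorem frame (h : Halts w p s T Q) :
    Halts w p s T fun s' => Q s' ∧ (∀ r, p.writesReg r = false → s'.reg r = s.reg r) ∧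
      ∀ i, p.writesMem i = false → s'.mem i = s.mem i := by
  obtain ⟨t, s', hr, ht, hQ⟩ := h
  exact ⟨t, s', hr, ht, hQ, fun _ => hr.reg_eq, fun _ => hr.mem_eq⟩

theorem mono (h : Halts w p s T Q) (hT : T ≤ T') (hQ : ∀ s', Q s' → R s') : Halts w p s T' R := by
  obtain ⟨t, s', hr, ht, h⟩ := h
  exact ⟨t, s', hr, ht.trans hT, hQ _ h⟩

theorem nil (h : Q s) : Halts w (.block []) s 1 Q :=
  ⟨_, _, .skip .., le_rfl, h⟩

theorem cons (hp : Halts w p s T Q) (hq : ∀ s', Q s' → Halts w (.block l) s' T' R) :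
    Halts w (.block (p :: l)) s (T + T') R := by
  obtain ⟨t, s', hr, ht, h⟩ := hp
  obtain ⟨t', s'', hr', ht', h'⟩ := hq _ h
  exact ⟨_, _, hr.seq hr', by omega, h'⟩

theorem const (hv : c < 2 ^ w) (h : Halts w (.block l) (s.setReg r c) T Q) :
    Halts w (.block (.const r c :: l)) s (1 + T) Q :=
  cons (Q := fun s' => s' = s.setReg r c)
    ⟨_, _, .const .., le_rfl, by rw [Nat.mod_eq_of_lt hv]⟩ (by rintro _ rfl; exact h)

theorem op (v : ℕ) (hx : s.reg a = x) (hy : s.reg b = y) (hv : o.eval w x y = v)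
    (h : Halts w (.block l) (s.setReg r v) T Q) :
    Halts w (.block (.op o r a b :: l)) s (1 + T) Q :=
  cons (Q := fun s' => s' = s.setReg r v) ⟨_, _, .op .., le_rfl, by rw [hx, hy, hv]⟩
    (by rintro _ rfl; exact h)

theorem load (v : ℕ) (hx : s.reg a = x) (hv : s.mem i x = v)
    (h : Halts w (.block l) (s.setReg r v) T Q) :
    Halts w (.block (.load r i a :: l)) s (1 + T) Q :=
  cons (Q := fun s' => s' = s.setReg r v) ⟨_, _, .load .., le_rfl, by rw [hx, hv]⟩
    (by rintro _ rfl; exact h)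

theorem store (x y : ℕ) (hx : s.reg a = x) (hy : s.reg b = y)
    (h : Halts w (.block l) (s.setMem i x y) T Q) :
    Halts w (.block (.store i a b :: l)) s (1 + T) Q :=
  cons (Q := fun s' => s' = s.setMem i x y) ⟨_, _, .store .., le_rfl, by rw [hx, hy]⟩
    (by rintro _ rfl; exact h)

theorem ite (b : Bool) (hb : s.reg r = b.toNat) (hp : b = true → Halts w p s T Q)
    (hq : b = false → Halts w q s T Q) : Halts w (.ite r p q) s (T + 1) Q := by
  cases b with
  | true =>
    obtain ⟨t, s', hr, ht, h⟩ := hp rfl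
    exact ⟨_, _, .ite_true (by simp [hb]) hr, by omega, h⟩
  | false =>
    obtain ⟨t, s', hr, ht, h⟩ := hq rfl
    exact ⟨_, _, .ite_false (by simp [hb]) hr, by omega, h⟩

end Halts

/-! ### The word operations on small numbers -/

theorem Op.eval_add (h : x + y < 2 ^ w) : Op.add.eval w x y = x + y := Nat.mod_eq_of_lt h

theorem Op.eval_mul (h : x * y < 2 ^ w) : Op.mul.eval w x y = x * y := Nat.mod_eq_of_lt h

theorem Op.eval_div (h : x < 2 ^ w) : Op.div.eval w x y = x / y :=
  Nat.mod_eq_of_lt ((Nat.div_le_self x y).trans_lt h)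

theorem Op.eval_mod (h : x < 2 ^ w) : Op.mod.eval w x y = x % y :=
  Nat.mod_eq_of_lt ((Nat.mod_le x y).trans_lt h)

theorem Op.eval_sub (h : y ≤ x) (hx : x < 2 ^ w) : Op.sub.eval w x y = x - y := by
  simp only [Op.eval]
  rw [Nat.mod_eq_of_lt (h.trans_lt hx), show x + (2 ^ w - y) = x - y + 2 ^ w by omega,
    Nat.add_mod_right, Nat.mod_eq_of_lt (by omega)]

theorem Op.eval_one_shl (h : 2 ^ y < 2 ^ w) : Op.shl.eval w 1 y = 2 ^ y := by
  change (1 <<< y) % 2 ^ w = _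
  rw [Nat.shiftLeft_eq, one_mul, Nat.mod_eq_of_lt h]

theorem toNat_lt_two_pow (hw : 1 < 2 ^ w) (b : Bool) : b.toNat < 2 ^ w :=
  (Bool.toNat_le b).trans_lt hw

theorem Op.eval_eq (hw : 1 < 2 ^ w) : Op.eq.eval w x y = (decide (x = y)).toNat := by
  by_cases h : x = y <;> simp [Op.eval, h, Nat.mod_eq_of_lt hw]

theorem Op.eval_lt (hw : 1 < 2 ^ w) : Op.lt.eval w x y = (decide (x < y)).toNat := by
  by_cases h : x < y <;> simp [Op.eval, h, Nat.mod_eq_of_lt hw]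

theorem Op.eval_or (hw : 1 < 2 ^ w) (a b : Bool) :
    Op.or.eval w a.toNat b.toNat = (a || b).toNat := by
  have : Nat.lor a.toNat b.toNat = _ := (by decide : ∀ a b : Bool, Nat.lor a.toNat b.toNat = (a || b).toNat) a b
  simp only [Op.eval, this, Nat.mod_eq_of_lt (toNat_lt_two_pow hw _)]

theorem Op.eval_and (hw : 1 < 2 ^ w) (a b : Bool) :
    Op.and.eval w a.toNat b.toNat = (a && b).toNat := by
  have : Nat.land a.toNat b.toNat = _ := (by decide : ∀ a b : Bool, Nat.land a.toNat b.toNat = (a && b).toNat) a b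
  simp only [Op.eval, this, Nat.mod_eq_of_lt (toNat_lt_two_pow hw _)]

theorem Op.eval_xor_one (hw : 1 < 2 ^ w) (a : Bool) : Op.xor.eval w a.toNat 1 = (!a).toNat := by
  have : Nat.xor a.toNat 1 = _ := (by decide : ∀ a : Bool, Nat.xor a.toNat 1 = (!a).toNat) a
  simp only [Op.eval, this, Nat.mod_eq_of_lt (toNat_lt_two_pow hw _)]

/-! ### Loops that count down -/

/-- Decrement the register `r` and run `q` until `r` is `0`; the register `u` holds `1`. -/
def Prog.countdown (r u : ℕ) (q : Prog) : Prog :=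
  .loop r (.seq (.op .sub r r u) q)

/-- Loop rule with an invariant indexed by the number of rounds left. The body starts with the
counter already decremented, and it may use that everything the loop never writes still has its
value from `s`. A round costs two extra steps, the test and the decrement; the last test adds one.
-/
theorem Halts.countdown {r u n : ℕ} (I : ℕ → State → Prop) (hn : s.reg r = n) (hw : n < 2 ^ w)
    (hu : s.reg u = 1) (hr : q.writesReg r = false)
    (hru : (Prog.countdown r u q).writesReg u = false) (h0 : I n s)
    (hstep : ∀ c < n, ∀ s' : State,
      (∀ x, (Prog.countdown r u q).writesReg x = false → s'.reg x = s.reg x) →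
      (∀ i, (Prog.countdown r u q).writesMem i = false → s'.mem i = s.mem i) →
      I (c + 1) s' → Halts w q (s'.setReg r c) T (I c)) :
    Halts w (.countdown r u q) s (n * (T + 2) + 1) (I 0) := by
  induction n generalizing s with
  | zero => exact ⟨_, _, .loop_false hn, by simp, h0⟩
  | succ n ih =>
    obtain ⟨t, s₁, hr₁, ht, h₁⟩ := hstep n (by omega) s (fun _ _ => rfl) (fun _ _ => rfl) h0
    have hsub : Runs w (.op .sub r r u) s 1 (s.setReg r n) := by
      have := Runs.op (w := w) s .sub r r u
      rwa [hn, hu, Op.eval_sub (by omega) hw] at this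
    have hbody := hsub.seq hr₁
    have e1 : ∀ x, (Prog.countdown r u q).writesReg x = false → s₁.reg x = s.reg x :=
      fun x hx => hbody.reg_eq hx
    have e2 : ∀ i, (Prog.countdown r u q).writesMem i = false → s₁.mem i = s.mem i :=
      fun i hi => hbody.mem_eq hi
    obtain ⟨t', s₂, hr₂, ht', h₂⟩ := ih (s := s₁) (by rw [hr₁.reg_eq hr]; simp) (by omega)
      (by rw [e1 u hru, hu]) h₁ fun c hc s' g1 g2 => hstep c (by omega) s'
        (fun x hx => (g1 x hx).trans (e1 x hx)) (fun i hi => (g2 i hi).trans (e2 i hi))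
    refine ⟨_, _, .loop_true (by simp [hn]) hbody hr₂, ?_, h₂⟩
    rw [add_mul]
    omega

/-! ### Renaming -/

/-- Rename the register `r` to `r + R` and the array `i` to `i + M`. -/
def Prog.shift (R M : ℕ) : Prog → Prog
  | .skip => .skip
  | .const r c => .const (r + R) c
  | .op o r a b => .op o (r + R) (a + R) (b + R)
  | .load r i a => .load (r + R) (i + M) (a + R)
  | .store i a b => .store (i + M) (a + R) (b + R)
  | .seq p q => .seq (p.shift R M) (q.shift R M)
  | .ite r p q => .ite (r + R) (p.shift R M) (q.shift R M)
  | .loop r p => .loop (r + R) (p.shift R M)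

/-- The registers from `R` on and the arrays from `M` on. -/
def State.tail (R M : ℕ) (s : State) : State where
  reg r := s.reg (r + R)
  mem i := s.mem (i + M)

theorem State.tail_setReg (R M : ℕ) (s : State) (r v : ℕ) :
    (s.setReg (r + R) v).tail R M = (s.tail R M).setReg r v := by
  simp only [State.tail, State.setReg, State.mk.injEq, and_true]
  funext x
  simp [Function.update_apply]

theorem State.tail_setMem (R M : ℕ) (s : State) (i a v : ℕ) :
    (s.setMem (i + M) a v).tail R M = (s.tail R M).setMem i a v := by
  simp only [State.tail, State.setMem, State.mk.injEq, true_and]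
  funext x
  by_cases h : x = i
  · subst h
    simp
  · simp [h]

/-- A renamed program sees only the tail of the state and simulates the original one step for step,
whatever the lower registers and arrays contain. -/
theorem Runs.shift (R M : ℕ) (h : Runs w p s t s') :
    ∀ S : State, S.tail R M = s → ∃ S', Runs w (p.shift R M) S t S' ∧ S'.tail R M = s' := by
  induction h with
  | skip s => exact fun S hS => ⟨S, .skip _, hS⟩
  | const s r c =>
    rintro S rfl
    exact ⟨_, .const .., State.tail_setReg ..⟩
  | op s o r a b =>
    rintro S rfl
    exact ⟨_, .op .., State.tail_setReg ..⟩
  | load s r i a =>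
    rintro S rfl
    exact ⟨_, .load .., State.tail_setReg ..⟩
  | store s i a b =>
    rintro S rfl
    exact ⟨_, .store .., State.tail_setMem ..⟩
  | seq _ _ ih ih' =>
    intro S hS
    obtain ⟨S', h, hS'⟩ := ih S hS
    obtain ⟨S'', h', hS''⟩ := ih' S' hS'
    exact ⟨S'', h.seq h', hS''⟩
  | ite_true h0 _ ih =>
    rintro S rfl
    obtain ⟨S', h, hS'⟩ := ih S rfl
    exact ⟨S', .ite_true h0 h, hS'⟩
  | ite_false h0 _ ih =>
    rintro S rfl
    obtain ⟨S', h, hS'⟩ := ih S rfl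
    exact ⟨S', .ite_false h0 h, hS'⟩
  | loop_true h0 _ _ ih ih' =>
    rintro S rfl
    obtain ⟨S', h, hS'⟩ := ih S rfl
    obtain ⟨S'', h', hS''⟩ := ih' S' hS'
    exact ⟨S'', .loop_true h0 h h', hS''⟩
  | loop_false h0 =>
    rintro S rfl
    exact ⟨S, .loop_false h0, rfl⟩

end WordRAM

namespace Reduction

open WordRAM

/-! ### The program of the reduction -/

/-- Does the literal with code `c` hold, if its variable is one of the `h` variables from `lo` on and
these have the bits of `i` as their values? -/
def litTrue (h lo i c : ℕ) : Bool :=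
  decide (lo ≤ c / 2) && decide (c / 2 - lo < h) &&
    decide ((i >>> (c / 2 - lo)) % 2 = c % 2)

/-- Is `r` the number of a clause, and does one of its literals hold in the sense of `litTrue`?
The clauses are given by their lengths and the codes of their literals. -/
def clauseSat (d h : ℕ) (len lit : ℕ → ℕ) (lo i r : ℕ) : Bool :=
  decide (1 ≤ r ∧ r ≤ d ∧ ∃ t < len (r - 1),
    litTrue h lo i (lit (∑ k ∈ Finset.range (r - 1), len k + t)) = true)

/-- Add up the first clause lengths. -/
def sumLoop : Prog := .countdown 18 3 (.block [.load 19 1 18, .op .add 17 17 19])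

/-- Test the literals of a clause. -/
def litLoop : Prog := .countdown 18 3 (.block [
  .op .add 19 17 18, .load 19 0 19, .op .div 20 19 4, .op .mod 19 19 4, .op .sub 20 20 15,
  .op .lt 21 20 5, .op .shr 20 13 20, .op .mod 20 20 4, .op .eq 20 20 19, .op .and 21 21 20,
  .op .or 16 16 21])

/-- Compute `clauseSat` in register `16`. -/
def clauseProg : Prog := .block [
  .op .sub 18 12 3, .load 29 1 18, .const 17 0, sumLoop, .op .add 18 29 30, litLoop]

/-- Compute `plusFlag` in register `14` and `clauseSat` in register `16`. -/
def satProg : Prog := .block [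
  .op .eq 14 12 30, .op .eq 16 12 10, .op .or 14 14 16, .const 16 0,
  .ite 14 .skip clauseProg]

/-- Write the first expression. -/
def plusLoop : Prog := .countdown 26 3 (.block [
  .op .mod 12 26 7, .op .div 13 26 7, satProg, .op .add 27 12 12, .op .or 28 16 14,
  .op .xor 28 28 3, .op .add 27 27 28, .store 2 26 27, .store 3 26 14])

/-- Write the second expression. -/
def orLoop : Prog := .countdown 26 3 (.block [
  .op .mod 12 26 7, .op .div 13 26 7, .op .sub 13 13 6, satProg,
  .op .lt 27 26 8, .op .lt 28 26 9, .op .xor 28 28 3, .op .or 27 27 28, .op .or 16 16 27,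
  .op .add 20 12 12, .op .add 21 20 16,
  .op .add 27 26 3, .op .lt 27 27 9, .op .xor 27 27 3, .op .mul 22 20 27,
  .op .lt 27 8 26, .op .sub 23 11 20, .op .mul 23 23 27, .op .add 23 23 20,
  .op .mul 25 26 24, .store 4 25 20, .op .add 25 25 3, .store 4 25 21, .op .add 25 25 3,
  .store 4 25 22, .op .add 25 25 3, .store 4 25 23, .store 5 26 24])

/-- Compute the parameters. -/
def prologue : Prog := .block [
  .const 3 1, .const 4 2, .const 24 4, .op .add 5 0 3, .op .div 5 5 4, .op .shl 6 3 5,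
  .op .add 7 1 4, .op .mul 8 6 7, .op .add 9 8 8, .op .add 10 1 3, .op .add 11 10 10,
  .op .add 32 8 30, .op .add 34 8 9, .op .mul 33 34 24]

/-- Write the two expressions into the registers from `32` on and the arrays from `2` on. -/
def reductionProg : Prog := .block [
  prologue, .op .add 15 30 30, .op .add 26 8 30, plusLoop,
  .op .add 15 5 30, .op .add 26 34 30, orLoop]

/-! ### Execution of the program: results, word bounds and step counts -/

/-- The parameters of the reduction are in their registers. -/
structure Setup (N d h : ℕ) (len lit : ℕ → ℕ) (s : State) : Prop where
  r3 : s.reg 3 = 1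
  r4 : s.reg 4 = 2
  r5 : s.reg 5 = h
  r6 : s.reg 6 = N
  r7 : s.reg 7 = d + 2
  r8 : s.reg 8 = N * (d + 2)
  r9 : s.reg 9 = 2 * (N * (d + 2))
  r10 : s.reg 10 = d + 1
  r11 : s.reg 11 = 2 * (d + 1)
  r24 : s.reg 24 = 4
  r30 : s.reg 30 = 0
  m0 : s.mem 0 = lit
  m1 : s.mem 1 = len

/-- The parameters of the reduction fit into words. -/
structure Bounds (w N d h L : ℕ) (len lit : ℕ → ℕ) : Prop where
  pos : 0 < N
  big : 12 * (N * (d + 2)) < 2 ^ w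
  half : 2 * h ≤ 2 ^ w
  total : L < 2 ^ w
  sum : ∀ r, ∑ k ∈ Finset.range r, len k ≤ L
  lit : ∀ p, lit p < 2 ^ w

variable {w N d h L : ℕ} {len lit : ℕ → ℕ} {s s' : State}

theorem Setup.congr (hs : Setup N d h len lit s)
    (hr : ∀ x ∈ [3, 4, 5, 6, 7, 8, 9, 10, 11, 24, 30], s'.reg x = s.reg x)
    (h0 : s'.mem 0 = s.mem 0) (h1 : s'.mem 1 = s.mem 1) : Setup N d h len lit s' := by
  simp only [List.mem_cons, List.not_mem_nil, or_false, forall_eq_or_imp, forall_eq] at hr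
  obtain ⟨a3, a4, a5, a6, a7, a8, a9, a10, a11, a24, a30⟩ := hr
  obtain ⟨b3, b4, b5, b6, b7, b8, b9, b10, b11, b24, b30, c0, c1⟩ := hs
  constructor <;> simp only [*]

namespace Bounds

variable (hb : Bounds w N d h L len lit)
include hb

theorem le_mul : d + 2 ≤ N * (d + 2) := Nat.le_mul_of_pos_left _ hb.pos

theorem one_lt : 1 < 2 ^ w := by
  have := hb.big
  have := hb.le_mul
  omega

theorem len_le (r : ℕ) : len r ≤ L := by
  have := hb.sum (r + 1)
  rw [Finset.sum_range_succ] at this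
  omega

end Bounds

theorem sumLoop_halts (hb : Bounds w N d h L len lit) (hs : Setup N d h len lit s) {n : ℕ}
    (hn : s.reg 18 = n) (hnw : n < 2 ^ w) (h0 : s.reg 17 = 0) :
    Halts w sumLoop s (n * 5 + 1) fun s' => s'.reg 17 = ∑ k ∈ Finset.range n, len k := by
  refine (Halts.countdown (T := 3)
    (fun c s' => s'.reg 17 + ∑ k ∈ Finset.range c, len k = ∑ k ∈ Finset.range n, len k)
    hn hnw hs.r3 (by decide) (by decide) (by simp [h0]) ?_).mono le_rfl (by simp)
  intro c hc s₁ hr hm hI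
  have m1 : s₁.mem 1 = len := (hm 1 (by decide)).trans hs.m1
  rw [Finset.sum_range_succ] at hI
  have := hb.sum n
  have := hb.total
  refine (Halts.load (len c) rfl (by simp [m1]) <|
    Halts.op (s₁.reg 17 + len c) (by simp) (by simp) (Op.eval_add (by omega)) <|
    Halts.nil ?_)
  simp
  omega

/-- The machine does not test `lo ≤ c / 2` separately: if it fails, the subtraction wraps around to
at least `2 ^ w - lo ≥ h`, and the comparison with `h` fails too. Reducing the shifted word modulo
`2 ^ w` preserves its parity. -/
theorem litTrue_eq {lo i c : ℕ} (hlo : lo + h ≤ 2 ^ w) (hw : 1 < 2 ^ w) (hc : c < 2 ^ w) :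
    (decide (Op.sub.eval w (c / 2) lo < h) &&
      decide (Op.shr.eval w i (Op.sub.eval w (c / 2) lo) % 2 = c % 2)) = litTrue h lo i c := by
  have hc2 : c / 2 ≤ c := Nat.div_le_self _ _
  have hmod : ∀ u, Op.shr.eval w i u % 2 = (i >>> u) % 2 := by
    intro u
    change (i >>> u) % 2 ^ w % 2 = _
    refine Nat.mod_mod_of_dvd _ (dvd_pow_self 2 ?_)
    rintro rfl
    simp at hw
  rw [hmod, litTrue]
  by_cases h1 : lo ≤ c / 2
  · rw [Op.eval_sub h1 (by omega)]
    simp [h1]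
  · have : ¬ Op.sub.eval w (c / 2) lo < h := by
      simp only [Op.eval]
      rcases Nat.lt_or_ge lo (2 ^ w) with h2 | h2
      · rw [Nat.mod_eq_of_lt h2, Nat.mod_eq_of_lt (by omega)]
        omega
      · omega
    simp [h1, this]

theorem litLoop_halts (hb : Bounds w N d h L len lit) (hs : Setup N d h len lit s) {n b i lo : ℕ}
    (hn : s.reg 18 = n) (hbn : b + n ≤ L) (h17 : s.reg 17 = b) (h16 : s.reg 16 = 0)
    (h13 : s.reg 13 = i) (h15 : s.reg 15 = lo) (hlo : lo ≤ h) :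
    Halts w litLoop s (n * 14 + 1) fun s' =>
      s'.reg 16 = (decide (∃ t < n, litTrue h lo i (lit (b + t)) = true)).toNat := by
  have hw := hb.one_lt
  have hL := hb.total
  have hh := hb.half
  refine (Halts.countdown (T := 12)
    -- Literals are scanned from the last to the first, so the part already examined is `c ≤ t < n`.
    (fun c s' => s'.reg 16 =
      (decide (∃ t < n, c ≤ t ∧ litTrue h lo i (lit (b + t)) = true)).toNat)
    hn (by omega) hs.r3 (by decide) (by decide) ?_ ?_).mono le_rfl (by simp)
  · rw [h16, eq_comm, Bool.toNat_eq_zero, decide_eq_false_iff_not]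
    rintro ⟨t, h1, h2, -⟩
    omega
  intro c hc s₁ hr hm hI
  have m0 : s₁.mem 0 = lit := (hm 0 (by decide)).trans hs.m0
  have r4 : s₁.reg 4 = 2 := (hr 4 (by decide)).trans hs.r4
  have r5 : s₁.reg 5 = h := (hr 5 (by decide)).trans hs.r5
  have r13 : s₁.reg 13 = i := (hr 13 (by decide)).trans h13
  have r15 : s₁.reg 15 = lo := (hr 15 (by decide)).trans h15
  have r17 : s₁.reg 17 = b := (hr 17 (by decide)).trans h17
  have hlit := hb.lit (b + c)
  have hlit2 : lit (b + c) / 2 < 2 ^ w := (Nat.div_le_self _ _).trans_lt hlit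
  have hsub : Op.sub.eval w (lit (b + c) / 2) lo < 2 ^ w := Nat.mod_lt _ (by omega)
  have hshr : Op.shr.eval w i (Op.sub.eval w (lit (b + c) / 2) lo) < 2 ^ w :=
    Nat.mod_lt _ (by omega)
  refine (Halts.op (b + c) (by simp [r17]) (by simp) (Op.eval_add (by omega)) <|
    Halts.load (lit (b + c)) (by simp; rfl) (by simp [m0]) <|
    Halts.op (lit (b + c) / 2) (by simp) (by simp [r4]) (Op.eval_div hlit) <|
    Halts.op (lit (b + c) % 2) (by simp) (by simp [r4]) (Op.eval_mod hlit) <|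
    Halts.op _ (by simp; rfl) (by simp [r15]; rfl) rfl <|
    Halts.op _ (by simp; rfl) (by simp [r5]; rfl) (Op.eval_lt hw) <|
    Halts.op _ (by simp [r13]; rfl) (by simp; rfl) rfl <|
    Halts.op _ (by simp) (by simp [r4]; rfl) (Op.eval_mod hshr) <|
    Halts.op _ (by simp; rfl) (by simp; rfl) (Op.eval_eq hw) <|
    Halts.op _ (by simp; rfl) (by simp; rfl) (Op.eval_and hw _ _) <|
    Halts.op _ (by simp [hI]; rfl) (by simp; rfl) (Op.eval_or hw _ _) <|
    Halts.nil ?_)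
  rw [litTrue_eq (by omega) hw hlit]
  simp only [State.setReg_reg, if_true]
  congr 1
  rw [Bool.eq_iff_iff]
  simp only [Bool.or_eq_true, decide_eq_true_eq]
  constructor
  · rintro (⟨t, h1, h2, h3⟩ | h3)
    · exact ⟨t, h1, by omega, h3⟩
    · exact ⟨c, hc, le_rfl, h3⟩
  · rintro ⟨t, h1, h2, h3⟩
    rcases Nat.eq_or_lt_of_le h2 with rfl | h2
    · exact Or.inr h3
    · exact Or.inl ⟨t, h1, h2, h3⟩

theorem clause_halts (hb : Bounds w N d h L len lit) (hs : Setup N d h len lit s) {r i lo : ℕ}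
    (h12 : s.reg 12 = r + 1) (hr : r < d) (h13 : s.reg 13 = i) (h15 : s.reg 15 = lo)
    (hlo : lo ≤ h) (h16 : s.reg 16 = 0) :
    Halts w clauseProg s (5 * d + 14 * L + 11) fun s' =>
      s'.reg 16 = (clauseSat d h len lit lo i (r + 1)).toNat := by
  have hL := hb.total
  have hbig := hb.big
  have hNd := hb.le_mul
  have hlen := hb.len_le r
  have hsum := hb.sum (r + 1)
  rw [Finset.sum_range_succ] at hsum
  have hloop := (sumLoop_halts (s := ((s.setReg 18 r).setReg 29 (len r)).setReg 17 0) hb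
    (hs.congr (by simp) (by simp) (by simp)) (n := r) (by simp) (by omega) (by simp)).frame
  refine (Halts.op r (by simp [h12]) (by simp [hs.r3])
      (Op.eval_sub (x := r + 1) (y := 1) (by omega) (by omega)) <|
    Halts.load (len r) (by simp; rfl) (by simp [hs.m1]) <|
    Halts.const (by omega) <|
    Halts.cons hloop fun s₁ ⟨e, fr, fm⟩ => ?_).mono
      (T := (1 + (1 + (1 + (r * 5 + 1 + (1 + (len r * 14 + 1 + 1)))))))
      (by omega) fun _ => id
  have hs₁ : Setup N d h len lit s₁ := hs.congr
    (fun x hx => (fr x (by revert x; decide)).trans (by revert x; simp))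
    (fm 0 (by decide)) (fm 1 (by decide))
  have f29 : s₁.reg 29 = len r := by rw [fr _ (by decide)]; simp
  have f13 : s₁.reg 13 = i := by rw [fr _ (by decide)]; simp [h13]
  have f15 : s₁.reg 15 = lo := by rw [fr _ (by decide)]; simp [h15]
  have f16 : s₁.reg 16 = 0 := by rw [fr _ (by decide)]; simp [h16]
  have hloop' := litLoop_halts (s := s₁.setReg 18 (len r)) hb
    (hs₁.congr (by simp) (by simp) (by simp)) (n := len r) (by simp) hsum (by simpa using e)
    (by simpa using f16) (by simpa using f13) (by simpa using f15) hlo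
  refine Halts.op (len r) (by simp [f29]) (by simp [hs₁.r30])
      (Op.eval_add (x := len r) (y := 0) (by omega)) <|
    Halts.cons hloop' fun s₂ e' => Halts.nil ?_
  rw [e', clauseSat]
  congr 2
  have : r + 1 ≤ d := by omega
  simp [this]

theorem satProg_halts (hb : Bounds w N d h L len lit) (hs : Setup N d h len lit s) {r i lo : ℕ}
    (h12 : s.reg 12 = r) (hr : r ≤ d + 1) (h13 : s.reg 13 = i) (h15 : s.reg 15 = lo)
    (hlo : lo ≤ h) :
    Halts w satProg s (5 * d + 14 * L + 20) fun s' =>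
      s'.reg 14 = (decide (r = 0) || decide (r = d + 1)).toNat ∧
        s'.reg 16 = (clauseSat d h len lit lo i r).toNat := by
  have hw := hb.one_lt
  have hL := hb.total
  have hbig := hb.big
  have hNd := hb.le_mul
  refine (Halts.op _ (by simp [h12]; rfl) (by simp [hs.r30]; rfl) (Op.eval_eq hw) <|
    Halts.op _ (by simp [h12]; rfl) (by simp [hs.r10]; rfl) (Op.eval_eq hw) <|
    Halts.op _ (by simp; rfl) (by simp; rfl) (Op.eval_or hw _ _) <|
    Halts.const (by omega) <|
    Halts.cons (Halts.ite (T := 5 * d + 14 * L + 11) (decide (r = 0) || decide (r = d + 1))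
      (by simp) ?_ ?_) fun s' h => Halts.nil (h : _ ∧ _)).mono (by omega) fun _ => id
  · intro hf
    refine ⟨_, _, .skip _, by omega, by simp, ?_⟩
    simp only [Bool.or_eq_true, decide_eq_true_eq] at hf
    -- At the two `+` coordinates the clause test is skipped; the preset `0` is right because
    -- `clauseSat` is false there.
    have : ¬ (1 ≤ r ∧ r ≤ d) := by omega
    simp only [clauseSat, ← and_assoc, this, false_and]
    simp
  · intro hf
    simp only [Bool.or_eq_false_iff, decide_eq_false_iff_not] at hf
    obtain ⟨r, rfl⟩ : ∃ k, r = k + 1 := ⟨r - 1, by omega⟩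
    refine (clause_halts hb ?_ (by simpa using h12) (by omega) (by simpa using h13)
      (by simpa using h15) hlo (by simp)).frame.mono le_rfl fun s' ⟨e, fr, _⟩ => ⟨?_, e⟩
    · exact hs.congr (by simp) (by simp) (by simp)
    · rw [fr _ (by decide)]
      simp

/-- A table that is filled from its end. -/
def table (f : ℕ → ℕ) (c n x : ℕ) : ℕ :=
  if c ≤ x ∧ x < n then f x else 0

theorem table_self (f : ℕ → ℕ) (n : ℕ) : table f n n = fun _ => 0 := by
  funext x
  exact if_neg (by omega)

theorem update_table (f : ℕ → ℕ) {c n : ℕ} (hc : c < n) :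
    Function.update (table f (c + 1) n) c (f c) = table f c n := by
  funext x
  simp only [table, Function.update_apply]
  split_ifs with h1 h2 h3 h4
  all_goals first | rfl | (exfalso; omega) | rw [h1]

/-- One round of the loop for the second expression writes the four letters of one position. -/
theorem update_four_table (f : ℕ → ℕ) {c n : ℕ} (hc : c < n) {x₀ x₁ x₂ x₃ : ℕ}
    (h₀ : f (c * 4) = x₀) (h₁ : f (c * 4 + 1) = x₁) (h₂ : f (c * 4 + 2) = x₂)
    (h₃ : f (c * 4 + 3) = x₃) :
    Function.update (Function.update (Function.update (Function.update
      (table f ((c + 1) * 4) (n * 4)) (c * 4) x₀) (c * 4 + 1) x₁) (c * 4 + 2) x₂) (c * 4 + 3) x₃ =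
      table f (c * 4) (n * 4) := by
  subst h₀ h₁ h₂ h₃
  funext x
  simp only [table, Function.update_apply]
  split_ifs with h1 h2 h3 h4
  all_goals first | rfl | (exfalso; omega) | simp only [*]

theorem plusLoop_halts (hb : Bounds w N d h L len lit) (hs : Setup N d h len lit s)
    (h26 : s.reg 26 = N * (d + 2)) (h15 : s.reg 15 = 0) (h2 : s.mem 2 = fun _ => 0)
    (h3 : s.mem 3 = fun _ => 0) :
    Halts w plusLoop s (N * (d + 2) * (5 * d + 14 * L + 37) + 1) fun s' =>
      s'.mem 2 = table (plusLetter d (clauseSat d h len lit 0)) 0 (N * (d + 2)) ∧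
      s'.mem 3 = table (fun x => (plusFlag d x).toNat) 0 (N * (d + 2)) := by
  have hw := hb.one_lt
  have hbig := hb.big
  have hNd := hb.le_mul
  refine (Halts.countdown (n := N * (d + 2)) (T := 5 * d + 14 * L + 35)
    (fun c s' => s'.mem 2 = table (plusLetter d (clauseSat d h len lit 0)) c (N * (d + 2)) ∧
      s'.mem 3 = table (fun x => (plusFlag d x).toNat) c (N * (d + 2)))
    h26 (by omega) hs.r3 (by decide) (by decide) (by simp [table_self, h2, h3]) ?_).mono
    le_rfl fun _ => id
  rintro c hc s₁ hr hm ⟨hI, hI'⟩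
  have hs₁ : Setup N d h len lit s₁ := hs.congr (fun x hx => hr x (by revert x; decide))
    (hm 0 (by decide)) (hm 1 (by decide))
  have r15 : s₁.reg 15 = 0 := (hr 15 (by decide)).trans h15
  have hmod : c % (d + 2) < d + 2 := Nat.mod_lt _ (by omega)
  refine (Halts.op (c % (d + 2)) (by simp) (by simp [hs₁.r7]) (Op.eval_mod (by omega)) <|
    Halts.op (c / (d + 2)) (by simp) (by simp [hs₁.r7]) (Op.eval_div (by omega)) <|
    Halts.cons (satProg_halts hb ?_ (r := c % (d + 2)) (i := c / (d + 2)) (lo := 0) (by simp) (by omega)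
      (by simp) (by simp [r15]) (by omega)).frame fun s₂ ⟨⟨e14, e16⟩, fr, fm⟩ => ?_).mono
    (T := 1 + (1 + (5 * d + 14 * L + 20 + (1 + (1 + (1 + (1 + (1 + (1 + 1)))))))))
    (by omega) fun _ => id
  · exact hs₁.congr (by simp) (by simp) (by simp)
  have hs₂ : Setup N d h len lit s₂ := hs₁.congr
    (fun x hx => (fr x (by revert x; decide)).trans (by revert x; simp))
    (fm 0 (by decide)) (fm 1 (by decide))
  have f12 : s₂.reg 12 = c % (d + 2) := by rw [fr _ (by decide)]; simp
  have f26 : s₂.reg 26 = c := by rw [fr _ (by decide)]; simp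
  obtain ⟨F, hF⟩ : ∃ F, F = (decide (c % (d + 2) = 0) || decide (c % (d + 2) = d + 1)) := ⟨_, rfl⟩
  obtain ⟨S, hS⟩ : ∃ S, S = clauseSat d h len lit 0 (c / (d + 2)) (c % (d + 2)) := ⟨_, rfl⟩
  rw [← hF] at e14
  rw [← hS] at e16
  have hB := Bool.toNat_le (!(S || F))
  refine Halts.op (c % (d + 2) + c % (d + 2)) (by simp [f12]) (by simp [f12])
      (Op.eval_add (by omega)) <|
    Halts.op (S || F).toNat (by simp [e16]) (by simp [e14]) (Op.eval_or hw _ _) <|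
    Halts.op (!(S || F)).toNat (by simp) (by simp [hs₂.r3]) (Op.eval_xor_one hw _) <|
    Halts.op (c % (d + 2) + c % (d + 2) + (!(S || F)).toNat) (by simp) (by simp)
      (Op.eval_add (by omega)) <|
    Halts.store c _ (by simp [f26]) (by simp; rfl) <|
    Halts.store c F.toNat (by simp [f26]) (by simp [e14]) <|
    Halts.nil ⟨?_, ?_⟩
  · simp only [State.setMem_mem, State.setReg_mem, reduceIte, Nat.reduceEqDiff,
      fm 2 (by decide), hI]
    rw [← update_table _ hc]
    congr 1
    simp only [plusLetter, plusFlag, ← hF, ← hS]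
    cases S <;> cases F <;> rfl
  · simp only [State.setMem_mem, State.setReg_mem, reduceIte, Nat.reduceEqDiff,
      fm 3 (by decide), hI']
    rw [hF]
    exact update_table (fun x => (plusFlag d x).toNat) hc

theorem orLoop_halts (hb : Bounds w N d h L len lit) (hs : Setup N d h len lit s)
    (h26 : s.reg 26 = 3 * (N * (d + 2))) (h15 : s.reg 15 = h) (h4 : s.mem 4 = fun _ => 0)
    (h5 : s.mem 5 = fun _ => 0) :
    Halts w orLoop s (3 * (N * (d + 2)) * (5 * d + 14 * L + 60) + 1) fun s' =>
      s'.mem 4 = table (fun x => (orLetters N d (clauseSat d h len lit h) (x / 4)).getD (x % 4) 0)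
        0 (3 * (N * (d + 2)) * 4) ∧
      s'.mem 5 = table (fun _ => 4) 0 (3 * (N * (d + 2))) := by
  have hw := hb.one_lt
  have hbig := hb.big
  have hNd := hb.le_mul
  refine (Halts.countdown (n := 3 * (N * (d + 2))) (T := 5 * d + 14 * L + 58)
    (fun c s' => s'.mem 4 = table
        (fun x => (orLetters N d (clauseSat d h len lit h) (x / 4)).getD (x % 4) 0)
        (c * 4) (3 * (N * (d + 2)) * 4) ∧
      s'.mem 5 = table (fun _ => 4) c (3 * (N * (d + 2))))
    h26 (by omega) hs.r3 (by decide) (by decide) (by simp [table_self, h4, h5]) ?_).mono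
    le_rfl (by simp)
  rintro c hc s₁ hr hm ⟨hI, hI'⟩
  have hs₁ : Setup N d h len lit s₁ := hs.congr (fun x hx => hr x (by revert x; decide))
    (hm 0 (by decide)) (hm 1 (by decide))
  have r15 : s₁.reg 15 = h := (hr 15 (by decide)).trans h15
  have hmod : c % (d + 2) < d + 2 := Nat.mod_lt _ (by omega)
  -- In the first universal part this subtraction wraps around and `i` is meaningless. This is
  -- harmless: `satProg_halts` allows any `i`, and the position is declared wild in any case.
  obtain ⟨i, hi⟩ : ∃ i, i = Op.sub.eval w (c / (d + 2)) N := ⟨_, rfl⟩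
  refine (Halts.op (c % (d + 2)) (by simp) (by simp [hs₁.r7]) (Op.eval_mod (by omega)) <|
    Halts.op (c / (d + 2)) (by simp) (by simp [hs₁.r7]) (Op.eval_div (by omega)) <|
    Halts.op i (by simp) (by simp [hs₁.r6]) hi.symm <|
    Halts.cons (satProg_halts hb ?_ (r := c % (d + 2)) (i := i) (lo := h) (by simp) (by omega)
      (by simp) (by simp [r15]) le_rfl).frame fun s₂ ⟨⟨_, e16⟩, fr, fm⟩ => ?_).mono
    (T := 1 + (1 + (1 + (5 * d + 14 * L + 20 + 30))))
    (by omega) fun _ => id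
  · exact hs₁.congr (by simp) (by simp) (by simp)
  have hs₂ : Setup N d h len lit s₂ := hs₁.congr
    (fun x hx => (fr x (by revert x; decide)).trans (by revert x; simp))
    (fm 0 (by decide)) (fm 1 (by decide))
  have f12 : s₂.reg 12 = c % (d + 2) := by rw [fr _ (by decide)]; simp
  have f26 : s₂.reg 26 = c := by rw [fr _ (by decide)]; simp
  obtain ⟨S, hS⟩ : ∃ S, S = clauseSat d h len lit h i (c % (d + 2)) := ⟨_, rfl⟩
  rw [← hS] at e16
  obtain ⟨B₁, hB₁⟩ : ∃ B, B = decide (c < N * (d + 2)) := ⟨_, rfl⟩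
  obtain ⟨B₂, hB₂⟩ : ∃ B, B = decide (c < 2 * (N * (d + 2))) := ⟨_, rfl⟩
  obtain ⟨B₃, hB₃⟩ : ∃ B, B = decide (c + 1 < 2 * (N * (d + 2))) := ⟨_, rfl⟩
  obtain ⟨B₄, hB₄⟩ : ∃ B, B = decide (N * (d + 2) < c) := ⟨_, rfl⟩
  -- If `B₁` holds, both sides are true irrespective of `i`; otherwise `N ≤ c / (d + 2)` and the
  -- subtraction is exact.
  have hwild : (S || (B₁ || !B₂)) = orWild N d (clauseSat d h len lit h) c := by
    rw [orWild, hS, hB₁, hB₂]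
    by_cases h1 : c < N * (d + 2)
    · simp [h1]
    · have : N ≤ c / (d + 2) := (Nat.le_div_iff_mul_le (by omega)).2 (by omega)
      rw [hi, Op.eval_sub this ((Nat.div_le_self _ _).trans_lt (by omega))]
      congr 2
      rw [← decide_not, decide_eq_decide, not_lt]
  obtain ⟨W, hW⟩ : ∃ W, W = (S || (B₁ || !B₂)) := ⟨_, rfl⟩
  have hWle := Bool.toNat_le W
  obtain ⟨r, hr'⟩ : ∃ r, r = c % (d + 2) := ⟨_, rfl⟩
  rw [← hr'] at hmod f12
  have hB₃le : (r + r) * (!B₃).toNat ≤ r + r := mul_le_of_le_one_right (Nat.zero_le _) (Bool.toNat_le _)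
  have hB₄le : (2 * (d + 1) - (r + r)) * B₄.toNat ≤ 2 * (d + 1) - (r + r) :=
    mul_le_of_le_one_right (Nat.zero_le _) (Bool.toNat_le _)
  refine Halts.mono (T := 1 + (1 + (1 + (1 + (1 + (1 + (1 + (1 + (1 + (1 + (1 + (1 + (1 + (1 + (1 +
    (1 + (1 + (1 + (1 + (1 + (1 + (1 + (1 + (1 + 1)))))))))))))))))))))))) ?_
      (by omega) fun _ => id
  refine Halts.op (x := c) (y := N * (d + 2)) B₁.toNat (by simp [f26]) (by simp [hs₂.r8]) (by rw [hB₁]; exact Op.eval_lt hw) <|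
    Halts.op (x := c) (y := 2 * (N * (d + 2))) B₂.toNat (by simp [f26]) (by simp [hs₂.r9]) (by rw [hB₂]; exact Op.eval_lt hw) <|
    Halts.op (!B₂).toNat (by simp) (by simp [hs₂.r3]) (Op.eval_xor_one hw _) <|
    Halts.op (B₁ || !B₂).toNat (by simp) (by simp) (Op.eval_or hw _ _) <|
    Halts.op (x := S.toNat) (y := (B₁ || !B₂).toNat) W.toNat (by simp [e16]) (by simp) (by rw [hW]; exact Op.eval_or hw _ _) <|
    Halts.op (r + r) (by simp [f12]) (by simp [f12]) (Op.eval_add (by omega)) <|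
    Halts.op (r + r + W.toNat) (by simp) (by simp) (Op.eval_add (by omega)) <|
    Halts.op (c + 1) (by simp [f26]) (by simp [hs₂.r3]) (Op.eval_add (by omega)) <|
    Halts.op (x := c + 1) (y := 2 * (N * (d + 2))) B₃.toNat (by simp) (by simp [hs₂.r9]) (by rw [hB₃]; exact Op.eval_lt hw) <|
    Halts.op (!B₃).toNat (by simp) (by simp [hs₂.r3]) (Op.eval_xor_one hw _) <|
    Halts.op ((r + r) * (!B₃).toNat) (by simp) (by simp) (Op.eval_mul (by omega)) <|
    Halts.op (x := N * (d + 2)) (y := c) B₄.toNat (by simp [hs₂.r8]) (by simp [f26]) (by rw [hB₄]; exact Op.eval_lt hw) <|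
    Halts.op (2 * (d + 1) - (r + r)) (by simp [hs₂.r11]) (by simp)
      (Op.eval_sub (by omega) (by omega)) <|
    Halts.op ((2 * (d + 1) - (r + r)) * B₄.toNat) (by simp) (by simp) (Op.eval_mul (by omega)) <|
    Halts.op ((2 * (d + 1) - (r + r)) * B₄.toNat + (r + r)) (by simp) (by simp)
      (Op.eval_add (by omega)) <|
    Halts.op (c * 4) (by simp [f26]) (by simp [hs₂.r24]) (Op.eval_mul (by omega)) <|
    Halts.store (c * 4) (r + r) (by simp) (by simp) <|
    Halts.op (c * 4 + 1) (by simp) (by simp [hs₂.r3]) (Op.eval_add (by omega)) <|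
    Halts.store (c * 4 + 1) (r + r + W.toNat) (by simp) (by simp) <|
    Halts.op (c * 4 + 2) (x := c * 4 + 1) (y := 1) (by simp) (by simp [hs₂.r3])
      (Op.eval_add (by omega)) <|
    Halts.store (c * 4 + 2) ((r + r) * (!B₃).toNat) (by simp) (by simp) <|
    Halts.op (c * 4 + 3) (x := c * 4 + 2) (y := 1) (by simp) (by simp [hs₂.r3])
      (Op.eval_add (by omega)) <|
    Halts.store (c * 4 + 3) ((2 * (d + 1) - (r + r)) * B₄.toNat + (r + r)) (by simp) (by simp) <|
    Halts.store c 4 (by simp [f26]) (by simp [hs₂.r24]) <|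
    Halts.nil ?_
  constructor
  · simp only [State.setMem_mem, State.setReg_mem, reduceIte, Nat.reduceEqDiff,
      fm 4 (by decide), hI]
    have hq : ∀ t < 4, (c * 4 + t) / 4 = c ∧ (c * 4 + t) % 4 = t := fun t ht => by omega
    refine update_four_table _ hc ?_ ?_ ?_ ?_
    · rw [← add_zero (c * 4), (hq 0 (by omega)).1, (hq 0 (by omega)).2]
      simp [orLetters, hr']
    · rw [(hq 1 (by omega)).1, (hq 1 (by omega)).2, hW, hwild, hr']
      cases h : orWild N d (clauseSat d _ len lit _) c <;> simp [orLetters, h]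
    · rw [(hq 2 (by omega)).1, (hq 2 (by omega)).2, hB₃, hr']
      by_cases h : c + 1 < 2 * (N * (d + 2)) <;> simp [orLetters, h]
    · rw [(hq 3 (by omega)).1, (hq 3 (by omega)).2, hB₄]
      by_cases h : N * (d + 2) < c <;> simp [orLetters, h, ← hr']
      omega
  · simp only [State.setMem_mem, State.setReg_mem, reduceIte, Nat.reduceEqDiff,
      fm 5 (by decide), hI']
    exact update_table (fun _ => 4) hc

theorem prologue_halts {n : ℕ} (hb : Bounds w (2 ^ ((n + 1) / 2)) d ((n + 1) / 2) L len lit)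
    (hn : n + 1 < 2 ^ w) (h0 : s.reg 0 = n) (h1 : s.reg 1 = d) (h30 : s.reg 30 = 0)
    (m0 : s.mem 0 = lit) (m1 : s.mem 1 = len) :
    Halts w prologue s 15 fun s' => Setup (2 ^ ((n + 1) / 2)) d ((n + 1) / 2) len lit s' ∧
      s'.reg 32 = 2 ^ ((n + 1) / 2) * (d + 2) ∧
      s'.reg 34 = 3 * (2 ^ ((n + 1) / 2) * (d + 2)) ∧
      s'.reg 33 = 12 * (2 ^ ((n + 1) / 2) * (d + 2)) := by
  have hbig := hb.big
  have hNd := hb.le_mul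
  obtain ⟨h, hh⟩ : ∃ h, h = (n + 1) / 2 := ⟨_, rfl⟩
  obtain ⟨N, hN⟩ : ∃ N, N = 2 ^ h := ⟨_, rfl⟩
  rw [← hh, ← hN] at hb hbig hNd ⊢
  have hNle : N ≤ N * (d + 2) := Nat.le_mul_of_pos_right _ (by omega)
  have hM : 0 ≤ N * (d + 2) := Nat.zero_le _
  generalize hNW : N * (d + 2) = M at *
  refine Halts.const (by omega) <| Halts.const (by omega) <| Halts.const (by omega) <|
    Halts.op (n + 1) (by simp [h0]) (by simp) (Op.eval_add (by omega)) <|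
    Halts.op h (by simp; rfl) (by simp; rfl) (by rw [hh]; exact Op.eval_div (by omega)) <|
    Halts.op N (by simp; rfl) (by simp; rfl)
      (by rw [hN]; exact Op.eval_one_shl (by omega)) <|
    Halts.op (d + 2) (by simp [h1]) (by simp) (Op.eval_add (by omega)) <|
    Halts.op M (by simp; rfl) (by simp; rfl)
      (by rw [← hNW]; exact Op.eval_mul (by omega)) <|
    Halts.op (M + M) (by simp) (by simp) (Op.eval_add (by omega)) <|
    Halts.op (d + 1) (by simp [h1]) (by simp) (Op.eval_add (by omega)) <|
    Halts.op (d + 1 + (d + 1)) (by simp) (by simp) (Op.eval_add (by omega)) <|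
    Halts.op (M + 0) (by simp) (by simp [h30]) (Op.eval_add (by omega)) <|
    Halts.op (M + (M + M)) (by simp) (by simp) (Op.eval_add (by omega)) <|
    Halts.op ((M + (M + M)) * 4) (by simp) (by simp) (Op.eval_mul (by omega)) <|
    Halts.nil ⟨?_, ?_, ?_, ?_⟩
  · constructor <;> simp [hNW, h30, m0, m1] <;> omega
  all_goals simp
  all_goals omega

theorem reductionProg_halts {n : ℕ}
    (hb : Bounds w (2 ^ ((n + 1) / 2)) d ((n + 1) / 2) L len lit)
    (hn : n + 1 < 2 ^ w) (h0 : s.reg 0 = n) (h1 : s.reg 1 = d) (h30 : s.reg 30 = 0)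
    (m0 : s.mem 0 = lit) (m1 : s.mem 1 = len) (hm : ∀ i, 2 ≤ i → s.mem i = fun _ => 0)
    (hN : N = 2 ^ ((n + 1) / 2)) (hh : h = (n + 1) / 2) :
    Halts w reductionProg s (N * (d + 2) * (4 * (5 * d + 14 * L + 60)) + 22) fun s' =>
      (s'.reg 32 = N * (d + 2) ∧ s'.reg 33 = 12 * (N * (d + 2)) ∧
        s'.reg 34 = 3 * (N * (d + 2))) ∧
      s'.mem 2 = table (plusLetter d (clauseSat d h len lit 0)) 0 (N * (d + 2)) ∧
      s'.mem 3 = table (fun x => (plusFlag d x).toNat) 0 (N * (d + 2)) ∧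
      s'.mem 4 = table (fun x => (orLetters N d (clauseSat d h len lit h) (x / 4)).getD (x % 4) 0)
        0 (3 * (N * (d + 2)) * 4) ∧
      s'.mem 5 = table (fun _ => 4) 0 (3 * (N * (d + 2))) := by
  have hp := (prologue_halts hb hn h0 h1 h30 m0 m1).frame
  rw [← hN, ← hh] at hb hp
  have hbig := hb.big
  have hhalf := hb.half
  have hlt := hb.one_lt
  refine (Halts.cons hp fun s₁ ⟨⟨hs₁, e32, e34, e33⟩, _, fm₁⟩ => ?_).mono
    (T := 15 + (1 + (1 + (N * (d + 2) * (5 * d + 14 * L + 37) + 1 + (1 + (1 +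
      (3 * (N * (d + 2)) * (5 * d + 14 * L + 60) + 1 + 1)))))))
    (by
      have : N * (d + 2) * (5 * d + 14 * L + 37) ≤ N * (d + 2) * (5 * d + 14 * L + 60) :=
        Nat.mul_le_mul_left _ (by omega)
      have e : 3 * (N * (d + 2)) * (5 * d + 14 * L + 60) =
        3 * (N * (d + 2) * (5 * d + 14 * L + 60)) := mul_assoc _ _ _
      have e' : N * (d + 2) * (4 * (5 * d + 14 * L + 60)) =
        4 * (N * (d + 2) * (5 * d + 14 * L + 60)) := by ring
      omega) fun _ => id
  have hp₂ := (plusLoop_halts (s := (s₁.setReg 15 0).setReg 26 (N * (d + 2))) hb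
    (hs₁.congr (by simp) (by simp) (by simp)) (by simp) (by simp)
    (by simp [fm₁ 2 (by decide), hm]) (by simp [fm₁ 3 (by decide), hm])).frame
  refine Halts.op (x := 0) (y := 0) 0 (by simp [hs₁.r30]) (by simp [hs₁.r30])
      (Op.eval_add (by omega)) <|
    Halts.op (x := N * (d + 2)) (y := 0) (N * (d + 2)) (by simp [hs₁.r8]) (by simp [hs₁.r30])
      (Op.eval_add (by omega)) <|
    Halts.cons hp₂ fun s₂ ⟨⟨f2, f3⟩, fr₂, fm₂⟩ => ?_
  have hs₂ : Setup N d h len lit s₂ := hs₁.congr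
    (fun x hx => (fr₂ x (by revert x; decide)).trans (by revert x; simp))
    (fm₂ 0 (by decide)) (fm₂ 1 (by decide))
  have g34 : s₂.reg 34 = 3 * (N * (d + 2)) := by rw [fr₂ _ (by decide)]; simpa using e34
  have hp₃ := (orLoop_halts (s := (s₂.setReg 15 h).setReg 26 (3 * (N * (d + 2)))) hb
    (hs₂.congr (by simp) (by simp) (by simp)) (by simp) (by simp)
    (by simp [fm₁ 4 (by decide), fm₂ 4 (by decide), hm])
    (by simp [fm₁ 5 (by decide), fm₂ 5 (by decide), hm])).frame
  refine Halts.op (x := h) (y := 0) h (by simp [hs₂.r5]) (by simp [hs₂.r30])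
      (Op.eval_add (by omega)) <|
    Halts.op (x := 3 * (N * (d + 2))) (y := 0) (3 * (N * (d + 2))) (by simp [g34])
      (by simp [hs₂.r30]) (Op.eval_add (by omega)) <|
    Halts.cons hp₃ fun s₃ ⟨⟨f4, f5⟩, fr₃, fm₃⟩ => Halts.nil ⟨⟨?_, ?_, ?_⟩, ?_, ?_, f4, f5⟩
  · rw [fr₃ _ (by decide)]
    simp [fr₂ 32 (by decide), e32]
  · rw [fr₃ _ (by decide)]
    simp [fr₂ 33 (by decide), e33]
  · rw [fr₃ _ (by decide)]
    simp [g34]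
  · rw [fm₃ _ (by decide)]
    exact f2
  · rw [fm₃ _ (by decide)]
    exact f3

/-- The solver expects zeros outside its input, so the registers behind the three parameters of the
instance must be untouched. -/
theorem writesReg_reductionProg (r : ℕ) (hr : 35 ≤ r) : reductionProg.writesReg r = false := by
  simp [reductionProg, prologue, plusLoop, orLoop, satProg, clauseProg, sumLoop, litLoop,
    Prog.block, Prog.countdown, Prog.writesReg]
  omega

theorem writesMem_reductionProg (i : ℕ) (hi : 6 ≤ i) : reductionProg.writesMem i = false := by
  simp [reductionProg, prologue, plusLoop, orLoop, satProg, clauseProg, sumLoop, litLoop,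
    Prog.block, Prog.countdown, Prog.writesMem]
  omega

/-! ### The lists behind the tables -/

theorem getD_map_range (f : ℕ → ℕ) (n x : ℕ) :
    ((List.range n).map f).getD x 0 = table f 0 n x := by
  by_cases h : x < n <;> simp [table, h]

/-- Every OR has exactly four leaves, with repeated letters as padding, so leaf `x` belongs to
position `x / 4`. This gives the program fixed addresses and makes the size independent of the
formula's truth values. -/
theorem flatten_map_range (g : ℕ → List ℕ) (hg : ∀ p, (g p).length = 4) (n : ℕ) :
    ((List.range n).map g).flatten =
      (List.range (n * 4)).map fun x => (g (x / 4)).getD (x % 4) 0 := by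
  induction n with
  | zero => simp
  | succ n ih =>
    rw [List.range_succ, List.map_append, List.flatten_append, ih, add_mul, one_mul,
      List.range_add, List.map_append]
    congr 1
    have h := hg n
    obtain ⟨a, b, c, e, he⟩ : ∃ a b c e, g n = [a, b, c, e] := by
      match g n, h with
      | [a, b, c, e], _ => exact ⟨a, b, c, e, rfl⟩
    have hq : ∀ t < 4, (n * 4 + t) / 4 = n ∧ (n * 4 + t) % 4 = t := fun t ht => by omega
    have h0 := hq 0 (by omega)
    have h1 := hq 1 (by omega)
    have h2 := hq 2 (by omega)
    have h3 := hq 3 (by omega)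
    rw [add_zero] at h0
    simp [List.range_succ, he, h0, h1, h2, h3]

theorem sum_range_getD (l : List ℕ) (r : ℕ) :
    ∑ k ∈ Finset.range r, l.getD k 0 = (l.take r).sum := by
  induction l generalizing r with
  | nil => simp
  | cons a l ih =>
    cases r with
    | zero => simp
    | succ r => rw [Finset.sum_range_succ']; simp [← ih, add_comm]

theorem length_orExpr_flatten {sat : ℕ → ℕ → Bool} :
    (orExpr N d sat).positions.flatten.length = 12 * (N * (d + 2)) := by
  rw [orExpr, flatten_map_range _ (fun _ => rfl)]
  simp
  omega

/-! ### Formulas -/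

/-- The lengths of the clauses. -/
def clauseLen (φ : CNF) (k : ℕ) : ℕ :=
  (φ.clauses.map List.length).getD k 0

/-- The codes of the literals. -/
def litCode (φ : CNF) (p : ℕ) : ℕ :=
  (φ.clauses.flatten.map fun l => 2 * (l.1 : ℕ) + l.2.toNat).getD p 0

theorem litTrue_code (h lo i v : ℕ) (b : Bool) :
    litTrue h lo i (2 * v + b.toNat) = true ↔
      lo ≤ v ∧ v < lo + h ∧ i.testBit (v - lo) = b := by
  have hb := Bool.toNat_le b
  have h1 : (2 * v + b.toNat) / 2 = v := by omega
  have h2 : (2 * v + b.toNat) % 2 = b.toNat := by omega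
  simp only [litTrue, h1, h2, Bool.and_eq_true, decide_eq_true_eq]
  rw [Nat.shiftRight_eq_div_pow, ← Nat.toNat_testBit, and_assoc]
  have : ((i.testBit (v - lo)).toNat = b.toNat) ↔ i.testBit (v - lo) = b := by
    cases i.testBit (v - lo) <;> cases b <;> simp
  rw [this]
  constructor
  · rintro ⟨h1, h2, h3⟩
    exact ⟨h1, by omega, h3⟩
  · rintro ⟨h1, h2, h3⟩
    exact ⟨h1, by omega, h3⟩

/-- The sum of the earlier clause lengths is the offset of clause `k` in the flattened literal
array. -/
theorem litCode_clause (φ : CNF) {k : ℕ} (hk : k < φ.clauses.length) {t : ℕ}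
    (ht : t < (φ.clauses[k]).length) :
    litCode φ (∑ j ∈ Finset.range k, clauseLen φ j + t) =
      2 * ((φ.clauses[k])[t].1 : ℕ) + (φ.clauses[k])[t].2.toNat := by
  have h := List.drop_take_succ_flatten_eq_getElem φ.clauses k hk
  have e : ∑ j ∈ Finset.range k, clauseLen φ j = ((φ.clauses.map List.length).take k).sum :=
    sum_range_getD _ _
  have : φ.clauses.flatten[((φ.clauses.map List.length).take k).sum + t]? =
      some (φ.clauses[k])[t] := by
    rw [← List.getElem?_drop]
    have h' : (φ.clauses[k])[t]? = some (φ.clauses[k])[t] := List.getElem?_eq_getElem ht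
    rw [← h', ← h, List.drop_take]
    rw [List.getElem?_take_of_lt]
    rw [List.sum_take_succ _ _ (by simpa using hk)]
    simpa using ht
  rw [litCode, e, List.getD_eq_getElem?_getD, List.getElem?_map, this]
  rfl

theorem clauseSat_eq_true (φ : CNF) (h lo i : ℕ) {k : ℕ} (hk : k < φ.clauses.length) :
    clauseSat φ.clauses.length h (clauseLen φ) (litCode φ) lo i (k + 1) = true ↔
      ∃ l ∈ φ.clauses[k], lo ≤ (l.1 : ℕ) ∧ (l.1 : ℕ) < lo + h ∧ i.testBit (l.1 - lo) = l.2 := by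
  have hlen : clauseLen φ k = (φ.clauses[k]).length := by simp [clauseLen, hk]
  have hk' : k + 1 ≤ φ.clauses.length := hk
  simp only [clauseSat, decide_eq_true_eq, Nat.add_sub_cancel, hlen, hk', true_and,
    Nat.le_add_left]
  constructor
  · rintro ⟨t, ht, h⟩
    rw [litCode_clause φ hk ht, litTrue_code] at h
    exact ⟨_, List.getElem_mem ht, h⟩
  · rintro ⟨l, hl, h⟩
    obtain ⟨t, ht, rfl⟩ := List.getElem_of_mem hl
    refine ⟨t, ht, ?_⟩
    rw [litCode_clause φ hk ht, litTrue_code]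
    exact h

/-- A half assignment is stored in the bits of a number below `2 ^ h`. A clause holds iff one of its
true literals lies in the lower or the upper half of the variables. -/
theorem satisfiable_iff (φ : CNF) (h : ℕ) (hh : φ.numVars ≤ h + h) :
    φ.Satisfiable ↔ ∃ i < 2 ^ h, ∃ j < 2 ^ h, ∀ r, 1 ≤ r → r ≤ φ.clauses.length →
      clauseSat φ.clauses.length h (clauseLen φ) (litCode φ) 0 i r = true ∨
        clauseSat φ.clauses.length h (clauseLen φ) (litCode φ) h j r = true := by
  constructor
  · rintro ⟨a, ha⟩
    -- The halves may cover more than `numVars` variables; the surplus ones occur in no clause and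
    -- get `false`.
    let f : ℕ → Bool := fun v => if hv : v < φ.numVars then a ⟨v, hv⟩ else false
    have hf : ∀ v : Fin φ.numVars, f v = a v := fun v => by simp [f]
    refine ⟨Nat.ofBits fun v : Fin h => f v, Nat.ofBits_lt_two_pow _,
      Nat.ofBits fun v : Fin h => f (h + v), Nat.ofBits_lt_two_pow _, ?_⟩
    rintro r hr hr'
    obtain ⟨k, rfl⟩ : ∃ k, r = k + 1 := ⟨r - 1, by omega⟩
    rw [clauseSat_eq_true φ h 0 _ hr', clauseSat_eq_true φ h h _ hr']
    obtain ⟨l, hl, e⟩ := ha _ (List.getElem_mem (show k < φ.clauses.length from hr'))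
    have hv := l.1.2
    rcases Nat.lt_or_ge l.1 h with h1 | h1
    · refine Or.inl ⟨l, hl, Nat.zero_le _, by omega, ?_⟩
      rw [Nat.sub_zero, Nat.testBit_ofBits_lt _ _ h1, ← e]
      exact hf _
    · refine Or.inr ⟨l, hl, h1, by omega, ?_⟩
      rw [Nat.testBit_ofBits_lt _ _ (by omega), ← e, ← hf]
      congr 1
      exact Nat.add_sub_of_le h1
  · rintro ⟨i, -, j, -, H⟩
    refine ⟨fun v => if (v : ℕ) < h then i.testBit v else j.testBit (v - h), fun C hC => ?_⟩
    obtain ⟨k, hk, rfl⟩ := List.getElem_of_mem hC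
    have := H (k + 1) (by omega) hk
    rw [clauseSat_eq_true φ h 0 _ hk, clauseSat_eq_true φ h h _ hk] at this
    rcases this with ⟨l, hl, h1, h2, h3⟩ | ⟨l, hl, h1, h2, h3⟩
    · refine ⟨l, hl, ?_⟩
      rw [zero_add] at h2
      simpa [h2] using h3
    · refine ⟨l, hl, ?_⟩
      simpa [not_lt.2 h1] using h3

/-! ### The word length -/

theorem sum_clauseLen_le (φ : CNF) (r : ℕ) :
    ∑ k ∈ Finset.range r, clauseLen φ k ≤ φ.clauses.flatten.length := by
  simp only [clauseLen]
  rw [sum_range_getD, List.length_flatten]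
  conv_rhs => rw [← List.take_append_drop r (φ.clauses.map List.length), List.sum_append]
  exact Nat.le_add_right _ _

theorem two_pow_half_mul_le (φ : CNF) :
    2 ^ ((φ.numVars + 1) / 2) * (φ.clauses.length + 2) ≤ 2 ^ φ.numVars * (φ.size + 2) := by
  refine Nat.mul_le_mul (Nat.pow_le_pow_right (by omega) (by omega)) ?_
  simp only [CNF.size]
  omega

theorem two_le_word (φ : CNF) : 2 ≤ 2 ^ φ.numVars * (φ.size + 2) := by
  have := Nat.mul_le_mul (Nat.one_le_two_pow (n := φ.numVars)) (Nat.le_add_left 2 φ.size)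
  omega

/-- The constant covers the total instance size `13 * (N * (d + 2))` and all words used by the
reduction. -/
theorem sixteen_mul_le {X : ℕ} (hX : 2 ≤ X) : 16 * X ≤ X ^ 5 := by
  have : 2 ^ 4 * X ≤ X ^ 4 * X := Nat.mul_le_mul_right _ (Nat.pow_le_pow_left hX 4)
  calc 16 * X = 2 ^ 4 * X := by norm_num
    _ ≤ X ^ 4 * X := this
    _ = X ^ 5 := by ring

theorem bounds_of_word (φ : CNF) (hw : (2 ^ φ.numVars * (φ.size + 2)) ^ 5 ≤ 2 ^ w)
    (hfit : φ.toInput.Fits w) :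
    Bounds w (2 ^ ((φ.numVars + 1) / 2)) φ.clauses.length ((φ.numVars + 1) / 2)
        φ.clauses.flatten.length (clauseLen φ) (litCode φ) ∧
      φ.numVars + 1 < 2 ^ w := by
  have h16 := sixteen_mul_le (two_le_word φ)
  have hS : φ.size + 2 ≤ 2 ^ φ.numVars * (φ.size + 2) :=
    Nat.le_mul_of_pos_left _ (by positivity)
  have hN := two_pow_half_mul_le φ
  have h2 := two_le_word φ
  have hsize : φ.size = φ.numVars + φ.clauses.length + φ.clauses.flatten.length := rfl
  refine ⟨⟨by positivity, by omega, by omega, by omega, sum_clauseLen_le φ, fun p => ?_⟩, by omega⟩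
  by_cases hp : p < φ.clauses.flatten.length
  · have := hfit.2 _ (List.mem_cons_self ..)
    refine this _ ?_
    rw [litCode, List.getD_eq_getElem _ _ (by rwa [List.length_map])]
    exact List.getElem_mem _
  · rw [litCode, List.getD_eq_default _ _ (by rw [List.length_map]; omega)]
    positivity

/-! ### The instances -/

variable {sat₁ sat₂ : ℕ → ℕ → Bool}

theorem plusExpr_size : (plusExpr N d sat₁).size = N * (d + 2) := by
  simp [ConcatPlus.size, plusExpr]

theorem orExpr_size : (orExpr N d sat₂).size = 12 * (N * (d + 2)) :=
  length_orExpr_flatten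

theorem plusExpr_hasDepthTwo (hN : 0 < N) : (plusExpr N d sat₁).HasDepthTwo := by
  refine ⟨(plusLetter d sat₁ 0, plusFlag d 0), ?_, by simp [plusFlag]⟩
  simp only [plusExpr, List.mem_map, List.mem_range]
  exact ⟨0, by positivity, rfl⟩

theorem orExpr_hasDepthTwo (hN : 0 < N) : (orExpr N d sat₂).HasDepthTwo := by
  constructor
  · intro S hS
    simp only [orExpr, List.mem_map, List.mem_range] at hS
    obtain ⟨p, -, rfl⟩ := hS
    simp [orLetters]
  · refine ⟨orLetters N d sat₂ 0, ?_, by simp [orLetters]⟩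
    simp only [orExpr, List.mem_map, List.mem_range]
    exact ⟨0, by positivity, rfl⟩

theorem plusLetter_lt (x : ℕ) : plusLetter d sat₁ x < 2 * d + 4 := by
  have : x % (d + 2) < d + 2 := Nat.mod_lt _ (by omega)
  rcases plusLetter_cases (d := d) (sat₁ := sat₁) x with h | ⟨-, -, h⟩ <;> omega

theorem orLetters_lt (p : ℕ) : ∀ a ∈ orLetters N d sat₂ p, a < 2 * d + 4 := by
  have : p % (d + 2) < d + 2 := Nat.mod_lt _ (by omega)
  intro a ha
  simp only [orLetters, List.mem_cons, List.not_mem_nil, or_false] at ha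
  split_ifs at ha <;> omega

theorem plusExpr_lettersBelow {σ : ℕ} (h : 2 * d + 4 ≤ σ) :
    (plusExpr N d sat₁).LettersBelow σ := by
  intro p hp
  simp only [plusExpr, List.mem_map, List.mem_range] at hp
  obtain ⟨x, -, rfl⟩ := hp
  exact (plusLetter_lt x).trans_le h

theorem orExpr_lettersBelow {σ : ℕ} (h : 2 * d + 4 ≤ σ) :
    (orExpr N d sat₂).LettersBelow σ := by
  intro S hS a ha
  simp only [orExpr, List.mem_map, List.mem_range] at hS
  obtain ⟨p, -, rfl⟩ := hS
  exact (orLetters_lt p a ha).trans_le h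

theorem intersectionInput_fits (hN : 0 < N) (hw : 12 * (N * (d + 2)) < 2 ^ w) :
    (intersectionInput (plusExpr N d sat₁) (orExpr N d sat₂)).Fits w := by
  have hNd : d + 2 ≤ N * (d + 2) := Nat.le_mul_of_pos_left _ hN
  have hA := plusExpr_lettersBelow (N := N) (sat₁ := sat₁) (le_refl (2 * d + 4))
  have hB := orExpr_lettersBelow (N := N) (sat₂ := sat₂) (le_refl (2 * d + 4))
  constructor
  · simp only [intersectionInput, plusExpr_size, orExpr_size, List.forall_mem_cons]
    refine ⟨by omega, by omega, ?_, by simp⟩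
    simp only [orExpr, List.length_map, List.length_range]
    omega
  · simp only [intersectionInput, List.forall_mem_cons]
    refine ⟨fun v hv => ?_, fun v hv => ?_, fun v hv => ?_, fun v hv => ?_, by simp⟩
    · obtain ⟨p, hp, rfl⟩ := List.mem_map.1 hv
      have := hA p hp
      omega
    · obtain ⟨p, hp, rfl⟩ := List.mem_map.1 hv
      have := Bool.toNat_le p.2
      omega
    · obtain ⟨S, hS, hv⟩ := List.mem_flatten.1 hv
      have := hB S hS v hv
      omega
    · obtain ⟨S, hS, rfl⟩ := List.mem_map.1 hv
      simp only [orExpr, List.mem_map] at hS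
      obtain ⟨p, -, rfl⟩ := hS
      simp only [orLetters, List.length_cons, List.length_nil]
      omega

/-- After the reduction, the renamed solver finds exactly its own initial state. -/
theorem tail_eq_init (h32 : s.reg 32 = N * (d + 2)) (h33 : s.reg 33 = 12 * (N * (d + 2)))
    (h34 : s.reg 34 = 3 * (N * (d + 2))) (hreg : ∀ r, 35 ≤ r → s.reg r = 0)
    (h2 : s.mem 2 = table (plusLetter d sat₁) 0 (N * (d + 2)))
    (h3 : s.mem 3 = table (fun x => (plusFlag d x).toNat) 0 (N * (d + 2)))
    (h4 : s.mem 4 = table (fun x => (orLetters N d sat₂ (x / 4)).getD (x % 4) 0)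
        0 (3 * (N * (d + 2)) * 4))
    (h5 : s.mem 5 = table (fun _ => 4) 0 (3 * (N * (d + 2))))
    (hmem : ∀ i, 6 ≤ i → s.mem i = fun _ => 0) :
    s.tail 32 2 = (intersectionInput (plusExpr N d sat₁) (orExpr N d sat₂)).init := by
  simp only [State.tail, Input.init, State.mk.injEq]
  constructor
  · funext r
    match r with
    | 0 => simp [intersectionInput, plusExpr_size, h32]
    | 1 => simp [intersectionInput, orExpr_size, h33]
    | 2 => simp [intersectionInput, orExpr, h34]
    | r + 3 => simp [intersectionInput, hreg]
  · funext i x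
    match i with
    | 0 =>
      rw [zero_add, h2, ← getD_map_range]
      simp [intersectionInput, plusExpr, Function.comp_def]
    | 1 =>
      rw [h3, ← getD_map_range]
      simp [intersectionInput, plusExpr, Function.comp_def]
    | 2 =>
      rw [h4, ← getD_map_range, ← flatten_map_range _ (fun _ => rfl)]
      simp [intersectionInput, orExpr]
    | 3 =>
      rw [h5, ← getD_map_range]
      simp [intersectionInput, orExpr, Function.comp_def, orLetters]
    | i + 4 => simp [intersectionInput, hmem]

/-! ### Running times -/

/-- Rounding `n / 2` up costs the factor `2`; `ε ≤ 1 / 2` puts `n / 2` below `(1 - ε) n`. -/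
theorem two_pow_half_le {n : ℕ} {ε : ℝ} (hε : ε ≤ 1 / 2) :
    ((2 ^ ((n + 1) / 2) : ℕ) : ℝ) ≤ 2 * (2 : ℝ) ^ ((1 - ε) * n) := by
  have h1 : (((n + 1) / 2 : ℕ) : ℝ) ≤ (n + 1) / 2 := by
    have := Nat.cast_div_le (α := ℝ) (m := n + 1) (n := 2)
    push_cast at this
    exact this
  have h2 : (0 : ℝ) ≤ n := Nat.cast_nonneg n
  have h3 : (n : ℝ) / 2 ≤ (1 - ε) * n := by nlinarith
  calc ((2 ^ ((n + 1) / 2) : ℕ) : ℝ) = (2 : ℝ) ^ (((n + 1) / 2 : ℕ) : ℝ) := by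
        rw [Real.rpow_natCast]
        push_cast
        rfl
    _ ≤ (2 : ℝ) ^ (1 + (1 - ε) * n) := Real.rpow_le_rpow_of_exponent_le (by norm_num) (by linarith)
    _ = 2 * (2 : ℝ) ^ ((1 - ε) * n) := by rw [Real.rpow_add (by norm_num), Real.rpow_one]

/-- The product of the sizes is at most `24 * S ^ 2 * 2 ^ n`, with `24 = 12 * 2` and the `2` from
rounding. The exponent `1 - ε` is needed in full on `2 ^ n` only; the polynomial factor is at least
`1`, so there it may be replaced by `1`. -/
theorem product_rpow_le {n d S : ℕ} {α ε : ℝ} (hε : ε ≤ α) (h0 : 0 ≤ ε) (h1 : ε ≤ 1 / 2)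
    (hd : d + 2 ≤ S) :
    (((2 ^ ((n + 1) / 2) * (d + 2) : ℕ) : ℝ) *
        ((12 * (2 ^ ((n + 1) / 2) * (d + 2)) : ℕ) : ℝ)) ^ (1 - α) ≤
      24 * (S : ℝ) ^ 2 * (2 : ℝ) ^ ((1 - ε) * n) := by
  have hS : (1 : ℝ) ≤ S := by
    have : 1 ≤ S := by omega
    exact_mod_cast this
  have hS2 : (1 : ℝ) ≤ 24 * (S : ℝ) ^ 2 := by nlinarith
  have hX1 : 1 ≤ (2 ^ ((n + 1) / 2) * (d + 2)) * (12 * (2 ^ ((n + 1) / 2) * (d + 2))) :=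
    Nat.succ_le_of_lt (by positivity)
  have hX2 : (2 ^ ((n + 1) / 2) * (d + 2)) * (12 * (2 ^ ((n + 1) / 2) * (d + 2))) ≤
      24 * S ^ 2 * 2 ^ n := by
    have h2 : 2 ^ ((n + 1) / 2) * 2 ^ ((n + 1) / 2) ≤ 2 * 2 ^ n := by
      rw [← pow_add, ← pow_succ']
      exact Nat.pow_le_pow_right (by omega) (by omega)
    have hd2 : (d + 2) * (d + 2) ≤ S * S := Nat.mul_le_mul hd hd
    calc _ = 12 * ((2 ^ ((n + 1) / 2) * 2 ^ ((n + 1) / 2)) * ((d + 2) * (d + 2))) := by ring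
      _ ≤ 12 * ((2 * 2 ^ n) * (S * S)) := Nat.mul_le_mul_left _ (Nat.mul_le_mul h2 hd2)
      _ = 24 * S ^ 2 * 2 ^ n := by ring
  rw [← Nat.cast_mul]
  generalize (2 ^ ((n + 1) / 2) * (d + 2)) * (12 * (2 ^ ((n + 1) / 2) * (d + 2))) = X at *
  have hX1' : (1 : ℝ) ≤ X := by exact_mod_cast hX1
  have hX2' : (X : ℝ) ≤ 24 * (S : ℝ) ^ 2 * (2 : ℝ) ^ n := by exact_mod_cast hX2
  calc (X : ℝ) ^ (1 - α) ≤ (X : ℝ) ^ (1 - ε) :=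
        Real.rpow_le_rpow_of_exponent_le hX1' (by linarith)
    _ ≤ (24 * (S : ℝ) ^ 2 * (2 : ℝ) ^ n) ^ (1 - ε) :=
        Real.rpow_le_rpow (by linarith) hX2' (by linarith)
    _ = (24 * (S : ℝ) ^ 2) ^ (1 - ε) * (2 : ℝ) ^ ((1 - ε) * n) := by
        rw [Real.mul_rpow (by positivity) (by positivity), ← Real.rpow_natCast 2 n,
          ← Real.rpow_mul (by norm_num), mul_comm (n : ℝ)]
    _ ≤ 24 * (S : ℝ) ^ 2 * (2 : ℝ) ^ ((1 - ε) * n) := by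
        gcongr
        calc (24 * (S : ℝ) ^ 2) ^ (1 - ε) ≤ (24 * (S : ℝ) ^ 2) ^ (1 : ℝ) :=
              Real.rpow_le_rpow_of_exponent_le hS2 (by linarith)
          _ = _ := Real.rpow_one _

/-! ### The reduction -/

/-- Reduce the formula in the input to an instance of intersection testing and solve it by `P`. -/
def solveProg (P : Prog) : Prog :=
  .block [reductionProg, P.shift 32 2, .ite 32 (.const 0 1) (.const 0 0)]

theorem kSATSolvable_of_intersectionTestingSolvable {c : ℕ} (hc : 1 ≤ c) {α : ℝ} (hα : 0 < α)
    {R : ℕ → ℕ → Prop} (hR : ∀ m, R m (12 * m))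
    (H : IntersectionTestingSolvable c R (fun m n => ((m : ℝ) * (n : ℝ)) ^ (1 - α))) (k : ℕ) :
    KSATSolvable k (min α (1 / 2)) := by
  obtain ⟨P, κ, D, hP⟩ := H
  -- With `X = 2 ^ numVars * (size + 2)`, the bound `16 * X ≤ X ^ 5` accounts for `5` in the
  -- reduction and `5 * κ` in the solver. The factor `265` is `2 * 120` from the two writing loops
  -- plus `22 + 3` for the overhead and the final steps. The absolute value is there since `D` may
  -- be negative.
  refine ⟨solveProg P, 5 * κ + 5, 2, 265 + 24 * |D|, fun φ _ w hw hfit => ?_⟩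
  obtain ⟨X, hX⟩ : ∃ X, X = 2 ^ φ.numVars * (φ.size + 2) := ⟨_, rfl⟩
  have hX2 : 2 ≤ X := hX ▸ two_le_word φ
  have h16 := sixteen_mul_le hX2
  have hw5 : X ^ 5 ≤ 2 ^ w :=
    (Nat.pow_le_pow_right (by omega) (by omega)).trans (hX ▸ hw)
  have hwκ : (X ^ 5) ^ κ ≤ 2 ^ w := by
    rw [← pow_mul]
    exact (Nat.pow_le_pow_right (by omega) (by omega)).trans (hX ▸ hw)
  obtain ⟨hb, hn⟩ := bounds_of_word φ (hX ▸ hw5) hfit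
  have hNX := two_pow_half_mul_le φ
  rw [← hX] at hNX
  have hpos := hb.pos
  have hbig := hb.big
  have hlt := hb.one_lt
  have hNd := hb.le_mul
  have hred := (reductionProg_halts (s := φ.toInput.init) hb hn (by simp [Input.init, CNF.toInput])
    (by simp [Input.init, CNF.toInput]) (by simp [Input.init, CNF.toInput])
    (by funext p; simp [Input.init, CNF.toInput, litCode])
    (by funext p; simp [Input.init, CNF.toInput, clauseLen])
    (by rintro (_ | _ | i) hi <;> first | omega | (funext x; simp [Input.init, CNF.toInput]))
    rfl rfl).frame
  obtain ⟨t₁, s₁, run₁, ht₁, ⟨⟨h32, h33, h34⟩, h2, h3, h4, h5⟩, fr, fm⟩ := hred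
  have hsat := satisfiable_iff φ ((φ.numVars + 1) / 2) (by omega)
  rw [← intersection_iff hpos] at hsat
  have htail := tail_eq_init h32 h33 h34
    (fun r hr => by
      rw [fr r (writesReg_reductionProg r hr)]
      obtain ⟨r, rfl⟩ := Nat.exists_eq_add_of_le' hr
      simp [Input.init, CNF.toInput])
    h2 h3 h4 h5
    (fun i hi => by
      rw [fm i (writesMem_reductionProg i hi)]
      obtain ⟨i, rfl⟩ := Nat.exists_eq_add_of_le' hi
      funext x
      simp [Input.init, CNF.toInput])
  have hσ : 2 * φ.clauses.length + 4 ≤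
      (2 ^ ((φ.numVars + 1) / 2) * (φ.clauses.length + 2) +
        12 * (2 ^ ((φ.numVars + 1) / 2) * (φ.clauses.length + 2))) ^ c :=
    le_trans (by omega) (Nat.le_self_pow (by omega) _)
  obtain ⟨t, s, run, hs, ht⟩ := hP _ _
    (plusExpr_hasDepthTwo (sat₁ := clauseSat φ.clauses.length ((φ.numVars + 1) / 2) (clauseLen φ)
      (litCode φ) 0) hpos)
    (orExpr_hasDepthTwo (sat₂ := clauseSat φ.clauses.length ((φ.numVars + 1) / 2) (clauseLen φ)
      (litCode φ) ((φ.numVars + 1) / 2)) hpos)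
    (plusExpr_lettersBelow (by rw [plusExpr_size, orExpr_size]; exact hσ))
    (orExpr_lettersBelow (by rw [plusExpr_size, orExpr_size]; exact hσ))
    (by rw [plusExpr_size, orExpr_size]; exact hR _) w
    (by
      rw [plusExpr_size, orExpr_size]
      exact (Nat.pow_le_pow_left (by omega) κ).trans hwκ)
    (intersectionInput_fits hpos hbig)
  rw [← hsat] at hs
  obtain ⟨S, run₂, hS⟩ := run.shift 32 2 s₁ htail
  have hS0 : S.reg 32 = s.reg 0 := by
    rw [← hS]
    rfl
  have hfin : ∃ s', Runs w (.ite 32 (.const 0 1) (.const 0 0)) S 2 s' ∧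
      (s'.reg 0 ≠ 0 ↔ φ.Satisfiable) := by
    rw [← hs, ← hS0]
    by_cases h0 : S.reg 32 = 0
    · exact ⟨_, .ite_false h0 (.const ..), by simp [h0]⟩
    · exact ⟨_, .ite_true h0 (.const ..), by simp [h0, Nat.mod_eq_of_lt hlt]⟩
  obtain ⟨s', run₃, hs'⟩ := hfin
  refine ⟨_, s', run₁.seq (run₂.seq (run₃.seq (.skip _))), hs', ?_⟩
  rw [plusExpr_size, orExpr_size] at ht
  have hdS : φ.clauses.length + 2 ≤ φ.size + 2 := by
    simp only [CNF.size]
    omega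
  have hprod := product_rpow_le (n := φ.numVars) (min_le_left α (1 / 2))
    (le_min hα.le (by norm_num)) (min_le_right α (1 / 2)) hdS
  have hhalf := two_pow_half_le (n := φ.numVars) (min_le_right α (1 / 2))
  have hE : (1 : ℝ) ≤ (2 : ℝ) ^ ((1 - min α (1 / 2)) * (φ.numVars : ℝ)) := by
    refine Real.one_le_rpow (by norm_num) (mul_nonneg ?_ (Nat.cast_nonneg _))
    linarith [min_le_right α (1 / 2)]
  generalize (2 : ℝ) ^ ((1 - min α (1 / 2)) * (φ.numVars : ℝ)) = E at *
  have hred : t₁ ≤ 2 ^ ((φ.numVars + 1) / 2) * (120 * (φ.size + 2) ^ 2) + 22 := by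
    refine ht₁.trans (Nat.add_le_add_right ?_ _)
    rw [mul_assoc]
    refine Nat.mul_le_mul_left _ ?_
    calc _ ≤ (φ.size + 2) * (120 * (φ.size + 2)) := by
          refine Nat.mul_le_mul hdS ?_
          simp only [CNF.size]
          omega
      _ = 120 * (φ.size + 2) ^ 2 := by ring
  have hred' : (t₁ : ℝ) ≤
      ((2 ^ ((φ.numVars + 1) / 2) : ℕ) : ℝ) * (120 * ((φ.size : ℝ) + 2) ^ 2) + 22 := by
    exact_mod_cast hred
  have hS1 : (1 : ℝ) ≤ ((φ.size : ℝ) + 2) ^ 2 := by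
    have : (0 : ℝ) ≤ φ.size := Nat.cast_nonneg _
    nlinarith
  have hES : (1 : ℝ) ≤ E * ((φ.size : ℝ) + 2) ^ 2 := one_le_mul_of_one_le_of_one_le hE hS1
  have h₁ : (t₁ : ℝ) ≤ 2 * E * (120 * ((φ.size : ℝ) + 2) ^ 2) + 22 :=
    hred'.trans (by gcongr)
  have h₂ : (t : ℝ) ≤ |D| * (24 * ((φ.size : ℝ) + 2) ^ 2 * E) := by
    refine ht.trans (mul_le_mul (le_abs_self D) ?_ (by positivity) (abs_nonneg D))
    refine hprod.trans (le_of_eq ?_)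
    push_cast
    rfl
  push_cast
  calc (t₁ : ℝ) + (t + 3)
      ≤ 240 * (E * ((φ.size : ℝ) + 2) ^ 2) + 25 + 24 * |D| * (E * ((φ.size : ℝ) + 2) ^ 2) := by
        linarith
    _ ≤ 240 * (E * ((φ.size : ℝ) + 2) ^ 2) + 25 * (E * ((φ.size : ℝ) + 2) ^ 2) +
          24 * |D| * (E * ((φ.size : ℝ) + 2) ^ 2) := by linarith
    _ = (265 + 24 * |D|) * E * ((φ.size : ℝ) + 2) ^ 2 := by ring

theorem not_intersectionTestingSolvable (hSETH : SETH) {c : ℕ} (hc : 1 ≤ c) {α : ℝ} (hα : 0 < α)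
    {R : ℕ → ℕ → Prop} (hR : ∀ m, R m (12 * m)) :
    ¬ IntersectionTestingSolvable c R (fun m n => ((m : ℝ) * (n : ℝ)) ^ (1 - α)) := by
  intro H
  obtain ⟨k, hk⟩ := hSETH (min α (1 / 2)) (lt_min hα (by norm_num))
  exact hk (kSATSolvable_of_intersectionTestingSolvable hc hα hR H k)

end Reduction

/-- Assuming SETH, for every `α > 0`, `(∘+, ∘|)`-intersection testing over integer alphabets of
polynomial size cannot be solved in time `O((m n) ^ (1 - α))`. This already holds for instances
whose sizes `m` and `n` agree up to an absolute constant factor `K`, where it is not merely due to the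
time needed to read the longer of the two expressions. -/
theorem mainTheorem1 (hSETH : SETH) :
    (∀ c : ℕ, 1 ≤ c → ∀ α : ℝ, 0 < α →
      ¬ IntersectionTestingSolvable c (fun _ _ => True)
          (fun m n => ((m : ℝ) * (n : ℝ)) ^ (1 - α))) ∧
    (∃ K : ℕ, ∀ c : ℕ, 1 ≤ c → ∀ α : ℝ, 0 < α →
      ¬ IntersectionTestingSolvable c (fun m n => m ≤ K * n ∧ n ≤ K * m)
          (fun m n => ((m : ℝ) * (n : ℝ)) ^ (1 - α))) := by
  -- `12 = 3 * 4`: there are `3N` blocks against `N` groups of the same length, and four leaves per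
  -- position.
  exact ⟨fun c hc α hα => Reduction.not_intersectionTestingSolvable hSETH hc hα fun _ => trivial,
    12, fun c hc α hα => Reduction.not_intersectionTestingSolvable hSETH hc hα
      fun m => ⟨by omega, le_rfl⟩⟩
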